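/- **Setting.** Let $\mathfrak{R}$ be a finite reduced crystallographic root system with a chosen set of simple roots and positive roots $\mathfrak{R}_+$, let $\tilde W$ be its Weyl group, let $\Omega$ be a group of automorphisms of $\mathfrak{R}$ permuting the simple roots (twists), and let $W=\Omega\ltimes\tilde W$ be the twisted Weyl group, acting on $\mathfrak{R}$. Let $\ell$ be the length function on $\tilde W$ with respect to simple reflections, extended to $W$ by giving twists length $0$. For $w\in W$ put $\mathfrak{R}_w:=\{\beta\in\mathfrak{R}_+: w(\beta)\notin\mathfrak{R}_+\}$, and let $\mathfrak{R}^w_{\mathrm{st}}$ be the set of roots whose orbit under $\langle w\rangle$ lies entirely in $\mathfrak{R}_+$ or entirely in $-\mathfrak{R}_+$. For $y,z\in W$ write $y\ge z$ (weak left order) if $y=xz$ for some $x\in W$ with $\ell(y)=\ell(x)+\ell(z)$. The braid monoid of $W$ is generated by elements $b_x$ ($x\in W$) with relations $b_1=1$ and $b_xb_y=b_{xy}$ whenever $\ell(xy)=\ell(x)+\ell(y)$. For $w\in W$ and $d\ge 0$, the right Deligne-Garside factor $\mathrm{DG}(b_w^d)$ is the unique $x\in\tilde W$ such that $b_w^d=c\,b_x$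 for some $c$ in the braid monoid and such that $x\ge y$ for every $y\in W$ for which $b_w^d=c'\,b_y$ for some $c'$. A set of roots is convex if it contains every root that is a positive real linear combination of two of its members. The element $w$ is called convex if $\mathfrak{R}_+\setminus\mathfrak{R}^w_{\mathrm{st}}$ is convex; its braid power bound $\mathrm{pb}(w)$ is then the unique element of $\tilde W$ whose inversion set is $\mathfrak{R}_{\mathrm{pb}(w)}=\mathfrak{R}_+\setminus\mathfrak{R}^w_{\mathrm{st}}$. For $\beta\in\mathfrak{R}_+$ put $$\mathrm{cross}_w(\beta):=\Bigl\{w\bigl(\beta+\sum_{i=1}^m\beta_i\bigr)\in\mathfrak{R}: m\ge 0,\ \beta_1,\dots,\beta_m\in\mathfrak{R}_w\Bigr\}\cap\mathfrak{R}_+,$$ for $\mathfrak{N}\subseteq\mathfrak{R}_+$ put $\mathrm{cross}_w(\mathfrak{N}):=\bigcup_{\beta\in\mathfrak{N}}\mathrm{cross}_w(\beta)$, and let $\mathrm{cross}_w^d$ be the $d$-th iterate of this map on subsets of $\mathfrak{R}_+$. **Lemma.** Let $w\in W$. The Deligne-Garside factors $\mathrm{DG}(b_w^d)$ exist and are unique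 for all $d\ge0$, and if $w$ is convex, so does $\mathrm{pb}(w)$ and it is unique. Moreover: (i) For any simple root $\alpha\notin\mathfrak{R}_w$, the set $\mathrm{cross}_w(\alpha)$ contains a simple root. (ii) For any $w'\in W$ and any integer $d\ge 0$, $$\mathrm{DG}(b_w^d)\ge w'\iff \mathrm{cross}_w^d(\mathfrak{R}_{w'})=\varnothing\iff \mathrm{cross}_w^d(\mathfrak{R}_{w'})\text{ contains no simple roots}.$$ (iii) For any integer $d>|\mathfrak{R}_+\setminus\mathfrak{R}^w_{\mathrm{st}}|-\ell(w)$, the element $w$ is convex and satisfies the braid equation $\mathrm{DG}(b_w^d)=\mathrm{pb}(w)$ if and only if $\mathrm{cross}_w^d(\mathfrak{R}_+\setminus\mathfrak{R}^w_{\mathrm{st}})=\varnothing$, if and only if $\mathrm{cross}_w^d(\mathfrak{R}_+\setminus\mathfrak{R}^w_{\mathrm{st}})$ contains no simple roots. -/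

import Mathlib

open scoped Pointwise

noncomputable section

namespace TwistedWeyl

variable {ι V V' : Type*} [AddCommGroup V] [Module ℝ V] [AddCommGroup V'] [Module ℝ V']
  {P : RootPairing ι ℝ V V'}

/-! ### Twisted Weyl groups -/

/-- Conjugating the reflection in a root by an automorphism gives the reflection in the image
root. -/
theorem conj_reflection (g : P.Aut) (i : ι) :
    g * RootPairing.Equiv.reflection P i * g⁻¹ =
      RootPairing.Equiv.reflection P (g • i) := by
  rw [mul_inv_eq_iff_eq_mul]
  apply RootPairing.Equiv.weightHom_injective P
  ext v
  have h₁ : P.coroot' (g • i) (g • v) = P.coroot' i v := by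
    have h := RootPairing.Hom.weight_coweight_transpose_apply P P (P.coroot (g • i)) g.toHom
    have h' := RootPairing.Hom.coroot_coweightMap_apply P P (g • i) g.toHom
    have h₂ : g.toHom.indexEquiv.symm (g • i) = i := g.toHom.indexEquiv.symm_apply_apply i
    rw [h', h₂] at h
    exact LinearMap.congr_fun h v
  have h₃ : P.root (g • i) = g • P.root i :=
    RootPairing.Equiv.root_indexEquiv_eq_smul (P := P) i g
  change g • (P.reflection i v) = P.reflection (g • i) (g • v)
  rw [RootPairing.reflection_apply, RootPairing.reflection_apply, h₁, h₃, smul_sub, smul_comm]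

/-- The Weyl group is a normal subgroup of the automorphism group of the root system. -/
instance weylGroup_normal : P.weylGroup.Normal := by
  refine ⟨fun x hx g => ?_⟩
  induction hx using RootPairing.weylGroup.induction with
  | mem i => rw [conj_reflection]; exact P.reflection_mem_weylGroup _
  | one => simp
  | mul x y _ _ h₁ h₂ =>
    have h : g * (x * y) * g⁻¹ = (g * x * g⁻¹) * (g * y * g⁻¹) := by group
    rw [h]
    exact mul_mem h₁ h₂

/-- The twists of the based root system: the automorphisms of the root system that permute the
simple roots. -/
def twists (b : P.Base) : Subgroup P.Aut :=
  MulAction.stabilizer P.Aut (b.support : Set ι)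

/-- A group `Ω` of automorphisms acts on the Weyl group by conjugation. -/
def conjAction (P : RootPairing ι ℝ V V') (Ω : Subgroup P.Aut) : Ω →* MulAut P.weylGroup :=
  (MulAut.conjNormal (H := P.weylGroup)).comp Ω.subtype

/-- The twisted Weyl group: the semidirect product of the Weyl group and a group `Ω` of twists. -/
abbrev TwistedWeylGroup (P : RootPairing ι ℝ V V') (Ω : Subgroup P.Aut) : Type _ :=
  P.weylGroup ⋊[conjAction P Ω] Ω

variable {Ω : Subgroup P.Aut}

/-- The action of the twisted Weyl group on the root system, `(x, δ) ↦ x ∘ δ`. -/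
def toAut : TwistedWeylGroup P Ω →* P.Aut :=
  SemidirectProduct.lift P.weylGroup.subtype Ω.subtype (by
    intro g; ext1 x; simp [conjAction])

/-- The inclusion of the (untwisted) Weyl group into the twisted one. -/
def ofWeyl (x : P.weylGroup) : TwistedWeylGroup P Ω := SemidirectProduct.inl x

/-! ### Length and weak order -/

/-- The length of an element of the Weyl group: the smallest length of an expression as a product
of simple reflections. -/
def weylLength (b : P.Base) (x : P.weylGroup) : ℕ :=
  sInf {n | ∃ l : List b.support, l.length = n ∧
    (l.map fun i => RootPairing.weylGroup.ofIdx P (i : ι)).prod = x}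

/-- The length on the twisted Weyl group; twists have length zero. -/
def length (b : P.Base) (w : TwistedWeylGroup P Ω) : ℕ := weylLength b w.left

/-- The weak left order `z ≤ y`: there is a decomposition `y = x z` with
`ℓ(y) = ℓ(x) + ℓ(z)`. -/
def WeakLE (b : P.Base) (z y : TwistedWeylGroup P Ω) : Prop :=
  ∃ x : TwistedWeylGroup P Ω, y = x * z ∧ length b y = length b x + length b z

/-! ### Braid monoid and Deligne-Garside factor -/

/-- The defining relations of the twisted braid monoid: `b_x b_y = b_{xy}` whenever
`ℓ(xy) = ℓ(x) + ℓ(y)`, and `b_1 = 1`. -/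
inductive BraidRel (b : P.Base) (Ω : Subgroup P.Aut) :
    FreeMonoid (TwistedWeylGroup P Ω) → FreeMonoid (TwistedWeylGroup P Ω) → Prop
  | one : BraidRel b Ω (FreeMonoid.of 1) 1
  | mul (x y : TwistedWeylGroup P Ω) (h : length b (x * y) = length b x + length b y) :
      BraidRel b Ω (FreeMonoid.of x * FreeMonoid.of y) (FreeMonoid.of (x * y))

/-- The (positive) braid monoid of the twisted Weyl group. -/
abbrev BraidMonoid (b : P.Base) (Ω : Subgroup P.Aut) : Type _ :=
  PresentedMonoid (BraidRel b Ω)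

/-- The reduced braid `b_w`. -/
def braid (b : P.Base) (w : TwistedWeylGroup P Ω) : BraidMonoid b Ω :=
  PresentedMonoid.of (BraidRel b Ω) w

/-- `b_y` is a right factor of the braid `c`. -/
def IsRightFactor (b : P.Base) (c : BraidMonoid b Ω) (y : TwistedWeylGroup P Ω) : Prop :=
  ∃ c' : BraidMonoid b Ω, c = c' * braid b y

/-- `x` is the right Deligne-Garside factor of `c`: the greatest element, in the weak left order,
whose reduced braid is a right factor of `c`. Twists being invertible, it is determined up to a
twist on its left; it is normalised by taking it in the untwisted Weyl group. -/
def IsDG (b : P.Base) (c : BraidMonoid b Ω) (x : P.weylGroup) : Prop :=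
  IsRightFactor b c (ofWeyl x) ∧ ∀ y, IsRightFactor b c y → WeakLE b y (ofWeyl x)

/-- The right Deligne-Garside factor `DG(c)`. -/
def DG (b : P.Base) (c : BraidMonoid b Ω) : P.weylGroup := Classical.epsilon (IsDG b c)

section Roots

variable (b : P.Base)

/-! ### Sets of roots; a root is represented by its index in `ι` -/

/-- The set of positive roots. -/
def posRoots : Set ι := {i | b.IsPos i}

/-- The inversion set of `w`: the positive roots that `w` maps to negative roots. -/
def inversionSet (w : TwistedWeylGroup P Ω) : Set ι :=
  {i | b.IsPos i ∧ ¬ b.IsPos (toAut w • i)}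

/-- The stable roots of `w`: the roots whose `w`-orbit consists entirely of positive roots or
entirely of negative roots. -/
def stableRoots (w : TwistedWeylGroup P Ω) : Set ι :=
  {i | (∀ n : ℤ, b.IsPos (toAut (w ^ n) • i)) ∨ (∀ n : ℤ, ¬ b.IsPos (toAut (w ^ n) • i))}

/-- A set of roots is convex if it contains every root that is a positive linear combination of
two of its members. -/
def IsConvexSet (P : RootPairing ι ℝ V V') (N : Set ι) : Prop :=
  ∀ i ∈ N, ∀ j ∈ N, ∀ s t : ℝ, 0 < s → 0 < t →
    ∀ k : ι, P.root k = s • P.root i + t • P.root j → k ∈ N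

/-- `w` is convex: the set of non-stable positive roots is convex. -/
def IsConvex (w : TwistedWeylGroup P Ω) : Prop :=
  IsConvexSet P (posRoots b \ stableRoots b w)

/-- `x` is the braid power bound of `w`: the element of the untwisted Weyl group whose inversion
set is the set of non-stable positive roots of `w`. -/
def IsPowerBound (w : TwistedWeylGroup P Ω) (x : P.weylGroup) : Prop :=
  inversionSet b (ofWeyl (Ω := Ω) x) = posRoots b \ stableRoots b w

/-- The braid power bound `pb(w)` (of a convex element `w`). -/
def pb (w : TwistedWeylGroup P Ω) : P.weylGroup := Classical.epsilon (IsPowerBound b w)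

/-! ### Crossing roots -/

/-- `cross_w(β)`: the positive roots of the form `w(β + β₁ + ⋯ + βₘ)` with `m ≥ 0` and
`β₁, …, βₘ` in the inversion set of `w` (repetitions allowed). -/
def crossRoot (w : TwistedWeylGroup P Ω) (β : ι) : Set ι :=
  {γ | b.IsPos γ ∧ ∃ l : List ι, (∀ i ∈ l, i ∈ inversionSet b w) ∧
    P.root γ = toAut w • (P.root β + (l.map P.root).sum)}

/-- `cross_w` on sets of positive roots. -/
def cross (w : TwistedWeylGroup P Ω) (N : Set ι) : Set ι := ⋃ β ∈ N, crossRoot b w β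

/-- The set `N` contains a simple root. -/
def HasSimple (N : Set ι) : Prop := ∃ i ∈ N, i ∈ b.support

end Roots

end TwistedWeyl

end

noncomputable section

namespace TwistedWeyl

variable {ι V V' : Type*} [AddCommGroup V] [Module ℝ V] [AddCommGroup V'] [Module ℝ V']
  {P : RootPairing ι ℝ V V'}

/-! ### The height functional and the invariant form -/

/-! Crossing is an action of the braid monoid on sets of positive roots. If lengths add in `x * y`,
then crossing `x * y` is crossing `y` and then `x` (`cross_mul`), and crossing `w'` annihilates its
own inversion set (`cross_inversionSet_self`). Hence if `b_w^d = c b_{w'}`, the `d`-th crossing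
iterate of `w` kills the inversions of `w'`.

For the converse, induct on `d`. The inversion set of the join `z w` of `w` and `w'` is the
sum-closure of the union of their inversion sets. Crossing takes a sum-closure into the sum-closure
of the crossing (`cross_sumClosure_subset`) and kills the inversions of `w`, so those of `z` are
sums of roots crossed from the inversions of `w'`. A sum of positive roots is never simple, so the
absence of simple roots passes to `z`: if `b_z` divides `b_w^d` on the right, then `b_w^(d+1)` is
divisible by `b_z b_w = b_{zw}`, hence by `b_{w'}`. At `d = 0`, a co-closed set without simple roots
is empty.

Biclosed sets of positive roots are exactly the inversion sets, and the sum-closure of a co-closed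
set is biclosed (`IsCoclosed.sumClosure`). Co-closed sets are stable under union, so there is a
greatest annihilated one, and its sum-closure gives the Deligne-Garside factor. The non-stable
positive roots form a co-closed set containing every annihilated set, so the braid equation holds
exactly when that set is annihilated.

The root combinatorics rests on a positive definite form for which two distinct roots with positive
product differ by a root. -/

theorem exists_heightFunctional [P.IsRootSystem] (b : P.Base) :
    ∃ f : V →ₗ[ℝ] ℝ, ∀ i, f (P.root i) = b.height i := by
  classical
  refine ⟨b.toWeightBasis.constr ℝ fun _ => (1 : ℝ), fun i => ?_⟩
  obtain ⟨g, -, -, hg⟩ := b.exists_root_eq_sum_int i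
  rw [RootPairing.Base.height_eq_sum hg, hg, map_sum]
  push_cast
  refine Finset.sum_congr rfl fun j hj => ?_
  have h := b.toWeightBasis.constr_basis ℝ (fun _ => (1 : ℝ)) ⟨j, hj⟩
  rw [RootPairing.Base.toWeightBasis_apply] at h
  rw [map_zsmul, h]
  simp

/-- The linear functional that takes the value `1` on the simple roots. -/
def heightFunctional [P.IsRootSystem] (b : P.Base) : V →ₗ[ℝ] ℝ :=
  (exists_heightFunctional b).choose

theorem heightFunctional_root [P.IsRootSystem] (b : P.Base) (i : ι) :
    heightFunctional b (P.root i) = b.height i :=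
  (exists_heightFunctional b).choose_spec i

/-- Makes positivity the sign of a linear functional, so that sums and real combinations of roots
are handled by arithmetic. -/
theorem isPos_iff_heightFunctional [P.IsRootSystem] (b : P.Base) {i : ι} :
    b.IsPos i ↔ 0 < heightFunctional b (P.root i) := by
  rw [heightFunctional_root, b.isPos_iff]
  exact Int.cast_pos.symm

theorem not_isPos_iff_heightFunctional [P.IsRootSystem] (b : P.Base) {i : ι} :
    ¬ b.IsPos i ↔ heightFunctional b (P.root i) < 0 := by
  rw [heightFunctional_root, b.isPos_iff, Int.cast_lt_zero]
  have := b.height_ne_zero i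
  omega

/-- The canonical root form works: on two roots it has the sign of their Cartan integer. -/
theorem exists_form (P : RootPairing ι ℝ V V') [Finite ι] [P.IsRootSystem] [P.IsCrystallographic] :
    ∃ B : LinearMap.BilinForm ℝ V, (∀ x y, B x y = B y x) ∧ (∀ x, x ≠ 0 → 0 < B x x) ∧
      ∀ i j, 0 < B (P.root i) (P.root j) → P.root i ≠ P.root j →
        ∃ k, P.root k = P.root i - P.root j := by
  have := Fintype.ofFinite ι
  refine ⟨P.RootForm, fun x y => P.rootForm_symmetric.eq x y, fun x hx => ?_, fun i j hij hne => ?_⟩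
  · exact P.rootForm_pos_of_ne_zero (by simp) hx
  · refine P.root_sub_root_mem_of_pairingIn_pos ?_ fun h => hne (by rw [h])
    have h := (P.posRootForm ℝ).toInvariantForm.two_mul_apply_root_root i j
    have hj : 0 < P.RootForm (P.root j) (P.root j) :=
      P.rootForm_pos_of_ne_zero (by simp) (P.ne_zero j)
    have h' : 2 * P.RootForm (P.root i) (P.root j) =
      P.pairing i j * P.RootForm (P.root j) (P.root j) := h
    have h₁ : 0 < P.pairing i j := by
      by_contra! hn
      nlinarith
    rw [← P.algebraMap_pairingIn ℤ] at h₁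
    exact Int.cast_pos.mp h₁

theorem exists_root_eq_neg (P : RootPairing ι ℝ V V') (i : ι) : ∃ j, P.root j = -P.root i :=
  ⟨P.reflectionPerm i i, by simp⟩

/-- If `a`, `b`, `c` and `a + b + c` are roots and no two of `a`, `b`, `c` are opposite, then
`a + c` or `b + c` is a root. -/
theorem exists_root_add_of_root_add_add [Finite ι] [P.IsRootSystem] [P.IsCrystallographic]
    {i j k l : ι} (h : P.root l = P.root i + P.root j + P.root k) (hij : P.root i + P.root j ≠ 0)
    (hik : P.root i + P.root k ≠ 0) (hjk : P.root j + P.root k ≠ 0) :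
    (∃ m, P.root m = P.root i + P.root k) ∨ ∃ m, P.root m = P.root j + P.root k := by
  obtain ⟨B, hB, hpos, hsub⟩ := exists_form P
  -- Write `a, b, c` for the summands. If neither sum is a root, then `a` and `b` have nonnegative
  -- product with `c`, and `a + b + c` has nonpositive product with `a` and with `b`. Adding up
  -- gives `B(a + b, a + b) ≤ 0`.
  by_contra! hn
  obtain ⟨h₁, h₂⟩ := hn
  have key (a c : ι) (hac : P.root a + P.root c ≠ 0)
      (hno : ∀ m, P.root m ≠ P.root a + P.root c) : 0 ≤ B (P.root a) (P.root c) := by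
    by_contra! hlt
    obtain ⟨c', hc'⟩ := exists_root_eq_neg P c
    obtain ⟨m, hm⟩ := hsub a c' (by rw [hc', map_neg]; linarith)
      (by rw [hc']; exact fun e => hac (by rw [e]; simp))
    exact hno m (by rw [hm, hc', sub_neg_eq_add])
  have e₁ := key i k hik h₁
  have e₂ := key j k hjk h₂
  have key' (a : ι) (v : V) (hv : P.root l = P.root a + v) (hv0 : v ≠ 0)
      (hno : ∀ m, P.root m ≠ v) : B (P.root l) (P.root a) ≤ 0 := by
    by_contra! hlt
    obtain ⟨m, hm⟩ := hsub l a hlt (by rw [hv]; simpa using hv0)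
    exact hno m (by rw [hm, hv]; abel)
  have e₃ := key' i (P.root j + P.root k) (by rw [h]; abel) hjk h₂
  have e₄ := key' j (P.root i + P.root k) (by rw [h]; abel) hik h₁
  have e₅ := hpos _ hij
  rw [h] at e₃ e₄
  simp only [map_add, LinearMap.add_apply] at e₃ e₄ e₅
  rw [hB (P.root k) (P.root i), hB (P.root j) (P.root i)] at e₃
  rw [hB (P.root k) (P.root j)] at e₄
  rw [hB (P.root j) (P.root i)] at e₅
  linarith

/-! ### Positivity and automorphisms -/

theorem root_smul (g : P.Aut) (i : ι) : P.root (g • i) = g • P.root i :=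
  RootPairing.Equiv.root_indexEquiv_eq_smul (P := P) i g

theorem root_smul_add (g : P.Aut) {i j k : ι} (h : P.root k = P.root i + P.root j) :
    P.root (g • k) = P.root (g • i) + P.root (g • j) := by
  rw [root_smul, root_smul, root_smul, h, smul_add]

theorem root_smul_neg (g : P.Aut) {i j : ι} (h : P.root j = -P.root i) :
    P.root (g • j) = -P.root (g • i) := by
  rw [root_smul, root_smul, h, smul_neg]

theorem root_injective (P : RootPairing ι ℝ V V') : Function.Injective P.root :=
  P.root.injective

section

variable [P.IsRootSystem] {b : P.Base}

theorem isPos_iff_not_of_neg {i j : ι} (h : P.root j = -P.root i) :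
    b.IsPos j ↔ ¬ b.IsPos i := by
  rw [isPos_iff_heightFunctional, not_isPos_iff_heightFunctional, h, map_neg, neg_pos]

theorem not_isPos_add {i j k : ι} (hi : ¬ b.IsPos i) (hj : ¬ b.IsPos j)
    (h : P.root k = P.root i + P.root j) : ¬ b.IsPos k := by
  rw [not_isPos_iff_heightFunctional] at *
  rw [h, map_add]
  linarith

theorem add_ne_zero_of_isPos {i j : ι} (hi : b.IsPos i) (hj : b.IsPos j) :
    P.root i + P.root j ≠ 0 := by
  rw [isPos_iff_heightFunctional] at hi hj
  intro h
  have := congrArg (heightFunctional b) h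
  rw [map_add, map_zero] at this
  linarith

end

/-- Simple roots have height one, a sum of two positive roots at least two. -/
theorem not_mem_support_of_add {b : P.Base} {i j k : ι} (hi : b.IsPos i) (hj : b.IsPos j)
    (h : P.root k = P.root i + P.root j) : k ∉ b.support := by
  intro hk
  have h₁ := b.height_add h
  rw [RootPairing.Base.height_one_of_mem_support hk] at h₁
  rw [b.isPos_iff] at hi hj
  omega

/-! ### Closures of sets of roots -/

/-- A set of roots is sum-closed if it contains every root that is a sum of two members. -/
def IsSumClosed (P : RootPairing ι ℝ V V') (N : Set ι) : Prop :=
  ∀ i ∈ N, ∀ j ∈ N, ∀ k, P.root k = P.root i + P.root j → k ∈ N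

/-- A set of positive roots is co-closed if its complement in the positive roots is sum-closed. -/
def IsCoclosed (b : P.Base) (N : Set ι) : Prop :=
  N ⊆ posRoots b ∧ ∀ k ∈ N, ∀ i j, b.IsPos i → b.IsPos j → P.root k = P.root i + P.root j →
    i ∈ N ∨ j ∈ N

/-- Membership in the sum-closure of a set of roots. -/
inductive SumClosureMem (P : RootPairing ι ℝ V V') (N : Set ι) : ι → Prop
  | base {i : ι} (h : i ∈ N) : SumClosureMem P N i
  | add {i j k : ι} (hi : SumClosureMem P N i) (hj : SumClosureMem P N j)
      (h : P.root k = P.root i + P.root j) : SumClosureMem P N k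

/-- The smallest sum-closed set of roots that contains `N`. -/
def sumClosure (P : RootPairing ι ℝ V V') (N : Set ι) : Set ι := {i | SumClosureMem P N i}

theorem subset_sumClosure (N : Set ι) : N ⊆ sumClosure P N := fun _ h => .base h

theorem isSumClosed_sumClosure (N : Set ι) : IsSumClosed P (sumClosure P N) :=
  fun _ hi _ hj _ h => .add hi hj h

theorem sumClosure_subset {N M : Set ι} (h : N ⊆ M) (hM : IsSumClosed P M) :
    sumClosure P N ⊆ M := by
  intro i hi
  induction hi with
  | base hi => exact h hi
  | add _ _ e h₁ h₂ => exact hM _ h₁ _ h₂ _ e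

theorem isSumClosed_posRoots (b : P.Base) : IsSumClosed P (posRoots b) :=
  fun _ hi _ hj _ h => RootPairing.Base.IsPos.add hi hj h

theorem sumClosure_subset_posRoots {b : P.Base} {N : Set ι} (h : N ⊆ posRoots b) :
    sumClosure P N ⊆ posRoots b :=
  sumClosure_subset h (isSumClosed_posRoots b)

theorem sumClosure_empty : sumClosure P (∅ : Set ι) = ∅ :=
  Set.subset_empty_iff.mp (sumClosure_subset subset_rfl fun _ h => h.elim)

/-- Sum-closedness lacks this property; joins are therefore built from co-closed sets and closed
under sums afterwards. -/
theorem IsCoclosed.union {b : P.Base} {N M : Set ι} (hN : IsCoclosed b N) (hM : IsCoclosed b M) :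
    IsCoclosed b (N ∪ M) := by
  refine ⟨Set.union_subset hN.1 hM.1, fun k hk i j hi hj h => ?_⟩
  rcases hk with hk | hk
  · exact (hN.2 k hk i j hi hj h).imp Or.inl Or.inl
  · exact (hM.2 k hk i j hi hj h).imp Or.inr Or.inr

theorem HasSimple.of_sumClosure {b : P.Base} {N : Set ι} (hN : N ⊆ posRoots b)
    (h : HasSimple b (sumClosure P N)) : HasSimple b N := by
  obtain ⟨i, hi, hs⟩ := h
  cases hi with
  | base hi => exact ⟨i, hi, hs⟩
  | add h₁ h₂ e =>
    exact (not_mem_support_of_add (sumClosure_subset_posRoots hN h₁)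
      (sumClosure_subset_posRoots hN h₂) e hs).elim

section

variable [Finite ι] [P.IsRootSystem] [P.IsCrystallographic] {b : P.Base}

/-- Two decompositions `a + b = c + d` of a root have a common refinement. -/
theorem exists_sub_root_of_add_eq_add {i j k l m : ι} (hi : P.root m = P.root i + P.root j)
    (hk : P.root m = P.root k + P.root l) :
    ∃ a ∈ ({i, j} : Set ι), ∃ c ∈ ({k, l} : Set ι), P.root a = P.root c ∨
      ∃ e, P.root e = P.root a - P.root c := by
  obtain ⟨B, hB, hpos, hsub⟩ := exists_form P
  -- The positive number `B(m, m)` expands into the four products `B(a, c)`, so one of them is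
  -- positive.
  have h := hpos _ (P.ne_zero m)
  have h' : B (P.root m) (P.root m) = B (P.root i + P.root j) (P.root k + P.root l) := by
    rw [← hi, ← hk]
  rw [h'] at h
  by_contra! hn
  have key : ∀ a ∈ ({i, j} : Set ι), ∀ c ∈ ({k, l} : Set ι), B (P.root a) (P.root c) ≤ 0 := by
    intro a ha c hc
    by_contra! hlt
    obtain ⟨e, he⟩ := hsub a c hlt (hn a ha c hc).1
    exact (hn a ha c hc).2 e he
  have h₁ := key i (by simp) k (by simp)
  have h₂ := key i (by simp) l (by simp)
  have h₃ := key j (by simp) k (by simp)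
  have h₄ := key j (by simp) l (by simp)
  simp only [map_add, LinearMap.add_apply] at h
  linarith

/-- Induction on the generation of `a + c = i + j`. After swapping summands, `a = i` or `m = a - i`
is a root. If `m` is positive, `a = i + m` is split by induction, and `m` in the closure puts `j = c
+ m` there. If not, `c = j + (-m)` is split, and `-m` in the closure puts `i = a + (-m)` there. -/
theorem IsCoclosed.sumClosure {N : Set ι} (hN : IsCoclosed b N) :
    IsCoclosed b (sumClosure P N) := by
  have hp := sumClosure_subset_posRoots hN.1
  refine ⟨hp, fun k hk => ?_⟩
  induction hk with
  | base h =>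
    intro i j hi hj e
    exact (hN.2 _ h i j hi hj e).imp (fun h => .base h) fun h => .base h
  | @add p q k hp' hq' e ihp ihq =>
    have main : ∀ a c, SumClosureMem P N a → SumClosureMem P N c →
        (∀ i j, b.IsPos i → b.IsPos j → P.root a = P.root i + P.root j →
          i ∈ TwistedWeyl.sumClosure P N ∨ j ∈ TwistedWeyl.sumClosure P N) →
        (∀ i j, b.IsPos i → b.IsPos j → P.root c = P.root i + P.root j →
          i ∈ TwistedWeyl.sumClosure P N ∨ j ∈ TwistedWeyl.sumClosure P N) →
        ∀ i j, b.IsPos i → b.IsPos j → P.root a + P.root c = P.root i + P.root j →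
        (P.root a = P.root i ∨ ∃ m, P.root m = P.root a - P.root i) →
        i ∈ TwistedWeyl.sumClosure P N ∨ j ∈ TwistedWeyl.sumClosure P N := by
      intro a c ha hc iha ihc i j hi hj hac h
      rcases h with h | ⟨m, hm⟩
      · exact .inl (root_injective P h ▸ ha)
      · by_cases hmp : b.IsPos m
        · rcases iha i m hi hmp (by rw [hm]; abel) with h | h
          · exact .inl h
          · refine .inr (.add hc h ?_)
            rw [hm, ← sub_eq_iff_eq_add'.mpr hac]; abel
        · obtain ⟨n, hn⟩ := exists_root_eq_neg P m
          have hnp := (isPos_iff_not_of_neg (b := b) hn).mpr hmp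
          rcases ihc j n hj hnp (by
            rw [hn, hm, ← sub_eq_iff_eq_add'.mpr hac]; abel) with h | h
          · exact .inr h
          · refine .inl (.add ha h ?_)
            rw [hn, hm]; abel
    intro i j hi hj e'
    obtain ⟨a, ha, c, hc, h⟩ := exists_sub_root_of_add_eq_add e e'
    rw [e] at e'
    rcases ha with rfl | ha <;> rcases hc with rfl | hc
    · exact main _ _ hp' hq' ihp ihq _ _ hi hj e' h
    · rw [Set.mem_singleton_iff] at hc
      subst hc
      exact (main _ _ hp' hq' ihp ihq _ _ hj hi (by rw [e', add_comm]) h).symm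
    · rw [Set.mem_singleton_iff] at ha
      subst ha
      exact main _ _ hq' hp' ihq ihp _ _ hi hj (by rw [← e', add_comm]) h
    · rw [Set.mem_singleton_iff] at ha hc
      subst ha hc
      exact (main _ _ hq' hp' ihq ihp _ _ hj hi (by rw [add_comm, e', add_comm]) h).symm

end

/-! ### Inversion sets of automorphisms -/

/-- The inversion set of an automorphism of the root system. -/
def autInversionSet (b : P.Base) (g : P.Aut) : Set ι := {i | b.IsPos i ∧ ¬ b.IsPos (g • i)}

theorem inversionSet_eq_autInversionSet (b : P.Base) {Ω : Subgroup P.Aut}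
    (w : TwistedWeylGroup P Ω) : inversionSet b w = autInversionSet b (toAut w) := rfl

theorem autInversionSet_one (b : P.Base) : autInversionSet b (1 : P.Aut) = ∅ := by
  ext i
  simp [autInversionSet]

theorem isSumClosed_autInversionSet [P.IsRootSystem] (b : P.Base) (g : P.Aut) :
    IsSumClosed P (autInversionSet b g) := fun _ hi _ hj _ h =>
  ⟨RootPairing.Base.IsPos.add hi.1 hj.1 h, not_isPos_add hi.2 hj.2 (root_smul_add g h)⟩

theorem isCoclosed_autInversionSet (b : P.Base) (g : P.Aut) :
    IsCoclosed b (autInversionSet b g) := by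
  refine ⟨fun _ h => h.1, fun k hk i j hi hj h => ?_⟩
  by_contra! hn
  have h₁ : b.IsPos (g • i) := by by_contra h'; exact hn.1 ⟨hi, h'⟩
  have h₂ : b.IsPos (g • j) := by by_contra h'; exact hn.2 ⟨hj, h'⟩
  exact hk.2 (h₁.add h₂ (root_smul_add g h))

theorem isConvexSet_autInversionSet [P.IsRootSystem] (b : P.Base) (g : P.Aut) :
    IsConvexSet P (autInversionSet b g) := by
  intro i hi j hj s t hs ht k hk
  have hk' : P.root (g • k) = s • P.root (g • i) + t • P.root (g • j) := by
    simp only [root_smul, hk, smul_add, smul_comm g]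
  obtain ⟨hi, hi'⟩ := hi
  obtain ⟨hj, hj'⟩ := hj
  refine ⟨?_, ?_⟩
  · rw [isPos_iff_heightFunctional] at *
    rw [hk, map_add, map_smul, map_smul, smul_eq_mul, smul_eq_mul]
    positivity
  · rw [not_isPos_iff_heightFunctional] at *
    rw [hk', map_add, LinearMap.map_smul, LinearMap.map_smul, smul_eq_mul, smul_eq_mul]
    nlinarith [mul_pos hs (neg_pos.mpr hi'), mul_pos ht (neg_pos.mpr hj')]

/-- If `g * h⁻¹` inverted `i`, then whichever of `±h⁻¹ i` is positive would be inverted by exactly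
one of `g` and `h`. -/
theorem autInversionSet_mul_inv_of_eq [P.IsRootSystem] {b : P.Base} {g h : P.Aut}
    (e : autInversionSet b g = autInversionSet b h) : autInversionSet b (g * h⁻¹) = ∅ := by
  rw [Set.eq_empty_iff_forall_notMem]
  rintro i ⟨hi, hn⟩
  rw [mul_smul] at hn
  by_cases hp : b.IsPos (h⁻¹ • i)
  · have h₁ : h⁻¹ • i ∈ autInversionSet b h := e ▸ ⟨hp, hn⟩
    exact h₁.2 (by simpa using hi)
  · obtain ⟨j, hj⟩ := exists_root_eq_neg P (h⁻¹ • i)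
    have hjp := (isPos_iff_not_of_neg (b := b) hj).mpr hp
    have h₁ : j ∈ autInversionSet b h := by
      refine ⟨hjp, ?_⟩
      rw [isPos_iff_not_of_neg (root_smul_neg h hj)]
      simpa using hi
    rw [← e] at h₁
    exact h₁.2 ((isPos_iff_not_of_neg (root_smul_neg g hj)).mpr hn)

/-! ### Words in the simple reflections -/

/-- The product of a word in the simple reflections. -/
def wordProd (b : P.Base) (l : List b.support) : P.weylGroup :=
  (l.map fun i => RootPairing.weylGroup.ofIdx P (i : ι)).prod

theorem wordProd_cons (b : P.Base) (i : b.support) (l : List b.support) :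
    wordProd b (i :: l) = RootPairing.weylGroup.ofIdx P (i : ι) * wordProd b l := by
  simp [wordProd]

theorem wordProd_append (b : P.Base) (l m : List b.support) :
    wordProd b (l ++ m) = wordProd b l * wordProd b m := by
  simp [wordProd]

theorem reflection_smul_index (i j : ι) :
    RootPairing.Equiv.reflection P i • j = P.reflectionPerm i j := rfl

theorem reflection_mul_self (i : ι) :
    RootPairing.Equiv.reflection P i * RootPairing.Equiv.reflection P i = 1 := by
  rw [mul_eq_one_iff_eq_inv, RootPairing.Equiv.reflection_inv]

theorem ofIdx_mul_self (i : ι) :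
    RootPairing.weylGroup.ofIdx P i * RootPairing.weylGroup.ofIdx P i = 1 :=
  Subtype.ext (reflection_mul_self i)

theorem ofIdx_smul_index (x : P.weylGroup) (i : ι) :
    RootPairing.weylGroup.ofIdx P (x • i) = x * RootPairing.weylGroup.ofIdx P i * x⁻¹ :=
  Subtype.ext (conj_reflection (x : P.Aut) i).symm

theorem not_isPos_reflection_smul_self [P.IsRootSystem] {b : P.Base} {j : ι} (hj : j ∈ b.support) :
    ¬ b.IsPos (RootPairing.Equiv.reflection P j • j) := by
  rw [isPos_iff_not_of_neg (i := j) (by simp [reflection_smul_index])]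
  exact not_not.mpr (RootPairing.Base.isPos_of_mem_support hj)

/-- Every positive root is built by adding simple roots one at a time; if none of these lie in `N`,
co-closedness keeps each partial sum out of `N`. -/
theorem exists_mem_support_of_isCoclosed [Finite ι] [P.IsCrystallographic] {b : P.Base}
    {N : Set ι} (hN : IsCoclosed b N) (hne : N.Nonempty) : ∃ i ∈ N, i ∈ b.support := by
  by_contra! hn
  obtain ⟨i, hi⟩ := hne
  have key : b.IsPos i → i ∉ N := fun hp => by
    have hind : b.IsPos i ∧ i ∉ N := by
      refine hp.induction_on_add (p := fun i => b.IsPos i ∧ i ∉ N) (fun i hi => ?_) ?_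
      · exact ⟨RootPairing.Base.isPos_of_mem_support hi, fun h => hn i h hi⟩
      · intro i j k e hi hj
        have hjp := RootPairing.Base.isPos_of_mem_support hj
        exact ⟨hi.1.add hjp e, fun hk =>
          (hN.2 k hk i j hi.1 hjp e).elim hi.2 fun h => hn j h hj⟩
    exact hind.2
  exact key (hN.1 hi) hi

section

variable [Finite ι] [P.IsCrystallographic] [P.IsReduced] (b : P.Base)

theorem exists_wordProd_eq_ofIdx (i : ι) :
    ∃ l, wordProd b l = RootPairing.weylGroup.ofIdx P i := by
  induction i using b.induction_reflect with
  | h₀ i h =>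
    obtain ⟨l, hl⟩ := h
    refine ⟨l, hl.trans ?_⟩
    have h := ofIdx_smul_index (RootPairing.weylGroup.ofIdx P i) i
    rw [mul_inv_cancel_right] at h
    exact h.symm
  | h₁ i hi => exact ⟨[⟨i, hi⟩], by simp [wordProd]⟩
  | h₂ i j h hj =>
    obtain ⟨l, hl⟩ := h
    refine ⟨[⟨j, hj⟩] ++ l ++ [⟨j, hj⟩], ?_⟩
    have h := ofIdx_smul_index (RootPairing.weylGroup.ofIdx P j) i
    rw [inv_eq_of_mul_eq_one_right (ofIdx_mul_self j)] at h
    rw [wordProd_append, wordProd_append, hl]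
    have e : wordProd b [⟨j, hj⟩] = RootPairing.weylGroup.ofIdx P j := by simp [wordProd]
    rw [e]
    exact h.symm

/-- The Weyl group is generated by the simple reflections. -/
theorem exists_wordProd_eq (x : P.weylGroup) : ∃ l, wordProd b l = x := by
  obtain ⟨x, hx⟩ := x
  induction hx using RootPairing.weylGroup.induction with
  | mem i => exact exists_wordProd_eq_ofIdx b i
  | one => exact ⟨[], rfl⟩
  | mul x y hx hy h₁ h₂ =>
    obtain ⟨l, hl⟩ := h₁
    obtain ⟨m, hm⟩ := h₂
    exact ⟨l ++ m, by rw [wordProd_append, hl, hm]; rfl⟩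

variable {b}

theorem isPos_reflection_smul {i j : ι} (hi : b.IsPos i) (hj : j ∈ b.support) (hij : i ≠ j) :
    b.IsPos (RootPairing.Equiv.reflection P j • i) :=
  hi.reflectionPerm hj hij

/-- The exchange property. -/
theorem exists_wordProd_eq_mul_ofIdx {i : ι} (hi : i ∈ b.support) (l : List b.support)
    (h : ¬ b.IsPos (wordProd b l • i)) :
    ∃ m, m.length + 1 = l.length ∧ wordProd b m = wordProd b l * RootPairing.weylGroup.ofIdx P i := by
  induction l with
  | nil => exact (h (by simpa [wordProd] using RootPairing.Base.isPos_of_mem_support hi)).elim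
  | cons j t ih =>
    by_cases hp : b.IsPos (wordProd b t • i)
    · have hj : wordProd b t • i = j := by
        by_contra hne
        refine h ?_
        rw [wordProd_cons, mul_smul]
        exact isPos_reflection_smul hp j.2 hne
      refine ⟨t, rfl, ?_⟩
      rw [wordProd_cons, ← hj, ofIdx_smul_index, inv_mul_cancel_right, mul_assoc, ofIdx_mul_self,
        mul_one]
    · obtain ⟨m, hm, e⟩ := ih hp
      refine ⟨j :: m, by simp [← hm], ?_⟩
      rw [wordProd_cons, wordProd_cons, e, mul_assoc]

/-- If `t s_i` inverts nothing, then `t` makes `i` negative, and the exchange property rewrites `t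
s_i` as a word two letters shorter. -/
theorem wordProd_eq_one_of_autInversionSet_eq_empty [P.IsRootSystem] (l : List b.support)
    (h : autInversionSet b (wordProd b l : P.Aut) = ∅) : wordProd b l = 1 := by
  induction hn : l.length using Nat.strong_induction_on generalizing l with
  | _ n ih =>
    rcases l.eq_nil_or_concat with rfl | ⟨t, i, rfl⟩
    · rfl
    · rw [List.concat_eq_append, wordProd_append] at h
      have hi : wordProd b [i] = RootPairing.weylGroup.ofIdx P (i : ι) := by simp [wordProd]
      rw [hi] at h
      have hpos : ¬ b.IsPos (wordProd b t • (i : ι)) := by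
        intro hp
        have h₁ : (i : ι) ∉ autInversionSet b
          ((wordProd b t * RootPairing.weylGroup.ofIdx P (i : ι) : P.weylGroup) : P.Aut) := by
          rw [h]; simp
        refine h₁ ⟨RootPairing.Base.isPos_of_mem_support i.2, ?_⟩
        change ¬ b.IsPos ((wordProd b t * RootPairing.weylGroup.ofIdx P (i : ι)) • (i : ι))
        rw [mul_smul]
        have h₂ : P.root (RootPairing.Equiv.reflection P (i : ι) • (i : ι)) = -P.root i := by
          simp [reflection_smul_index]
        exact fun hc => (isPos_iff_not_of_neg
          (root_smul_neg (wordProd b t : P.Aut) h₂)).mp hc hp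
      obtain ⟨m, hm, e⟩ := exists_wordProd_eq_mul_ofIdx i.2 t hpos
      have hl : wordProd b (t.concat i) = wordProd b m := by
        rw [List.concat_eq_append, wordProd_append, hi, e]
      rw [hl]
      refine ih m.length ?_ m ?_ rfl
      · rw [← hn, List.length_concat]; omega
      · rw [e]; exact h

theorem weyl_eq_of_autInversionSet_eq [P.IsRootSystem] {x y : P.weylGroup}
    (h : autInversionSet b (x : P.Aut) = autInversionSet b (y : P.Aut)) : x = y := by
  obtain ⟨l, hl⟩ := exists_wordProd_eq b (x * y⁻¹)
  rw [← mul_inv_eq_one, ← hl]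
  refine wordProd_eq_one_of_autInversionSet_eq_empty l ?_
  rw [hl]
  exact autInversionSet_mul_inv_of_eq h

/-- A biclosed set of positive roots is the inversion set of an element of the Weyl group, whose
length is at most the cardinality of the set. -/
theorem exists_wordProd_autInversionSet_eq [P.IsRootSystem] {N : Set ι} (hc : IsSumClosed P N)
    (hN : IsCoclosed b N) :
    ∃ l : List b.support, l.length = N.ncard ∧ autInversionSet b (wordProd b l : P.Aut) = N := by
  induction hn : N.ncard generalizing N with
  | zero =>
    rw [Set.ncard_eq_zero] at hn
    exact ⟨[], rfl, by rw [hn]; exact autInversionSet_one b⟩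
  | succ n ih =>
    obtain ⟨a, haN, ha⟩ := exists_mem_support_of_isCoclosed hN
      (Set.nonempty_of_ncard_ne_zero (by omega))
    set s := RootPairing.Equiv.reflection P a with hs
    have hss (i : ι) : s • s • i = i := by rw [← mul_smul, hs, reflection_mul_self, one_smul]
    have hsa : P.root (s • a) = -P.root a := by simp [hs, reflection_smul_index]
    have hap : b.IsPos a := hN.1 haN
    have hsap : ¬ b.IsPos (s • a) := not_isPos_reflection_smul_self ha
    -- Peeling off the simple root `a`: `N` is `{a}` together with `s M`, and `M` is again biclosed
    -- with one element fewer.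
    set M : Set ι := {i | b.IsPos i ∧ s • i ∈ N} with hM
    have haM : a ∉ M := fun h => hsap (hN.1 h.2)
    have hNM : N = insert a ((s • ·) '' M) := by
      ext i
      constructor
      · intro hi
        by_cases hia : i = a
        · exact .inl hia
        · exact .inr ⟨s • i, ⟨isPos_reflection_smul (hN.1 hi) ha hia, by rwa [hss]⟩, hss i⟩
      · rintro (rfl | ⟨j, hj, rfl⟩)
        · exact haN
        · exact hj.2
    have hcard : M.ncard = n := by
      rw [hNM, Set.ncard_insert_of_notMem, Set.ncard_image_of_injective _ (MulAction.injective s)]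
        at hn
      · omega
      · rintro ⟨j, hj, e⟩
        have : j = s • a := by rw [← e, hss]
        exact hsap (this ▸ hj.1)
    have hMc : IsSumClosed P M := fun i hi j hj k e =>
      ⟨hi.1.add hj.1 e, hc _ hi.2 _ hj.2 _ (root_smul_add s e)⟩
    have hMN : IsCoclosed b M := by
      refine ⟨fun _ h => h.1, fun k hk i j hi hj e => ?_⟩
      have e' := root_smul_add s e
      -- If one summand is `a`, then `s k = s j - a`, so `s j = s k + a` lies in `N` by
      -- sum-closedness.
      by_cases hia : i = a
      · subst hia
        exact .inr ⟨hj, hc _ hk.2 _ haN _ (by rw [e', hsa]; abel)⟩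
      · by_cases hja : j = a
        · subst hja
          exact .inl ⟨hi, hc _ hk.2 _ haN _ (by rw [e', hsa]; abel)⟩
        · exact (hN.2 _ hk.2 _ _ (isPos_reflection_smul hi ha hia)
            (isPos_reflection_smul hj ha hja) e').imp (fun h => ⟨hi, h⟩) fun h => ⟨hj, h⟩
    obtain ⟨l, hl, e⟩ := ih hMc hMN hcard
    refine ⟨l ++ [⟨a, ha⟩], by simp [hl], ?_⟩
    have hprod (i : ι) : ((wordProd b (l ++ [⟨a, ha⟩]) : P.weylGroup) : P.Aut) • i =
        (wordProd b l : P.Aut) • s • i := by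
      rw [wordProd_append, ← mul_smul]
      simp [wordProd, RootPairing.weylGroup.ofIdx, hs]
    have hmem (i : ι) (hi : b.IsPos i) : b.IsPos ((wordProd b l : P.Aut) • i) ↔ i ∉ M := by
      rw [← e]
      simp [autInversionSet, hi]
    ext i
    by_cases hip : b.IsPos i
    · by_cases hia : i = a
      · subst hia
        refine iff_of_true ⟨hip, ?_⟩ haN
        rw [hprod, isPos_iff_not_of_neg (root_smul_neg _ hsa), not_not]
        exact (hmem _ hap).mpr haM
      · have hsi : b.IsPos (s • i) := isPos_reflection_smul hip ha hia
        change b.IsPos i ∧ ¬ _ ↔ _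
        rw [hprod, hmem _ hsi, not_not, hM]
        simp only [Set.mem_ofPred_eq, hip, hsi, hss, true_and]
    · exact iff_of_false (fun h => hip h.1) fun h => hip (hN.1 h)

theorem exists_weyl_autInversionSet_eq [P.IsRootSystem] {N : Set ι} (hc : IsSumClosed P N)
    (hN : IsCoclosed b N) : ∃ x : P.weylGroup, autInversionSet b (x : P.Aut) = N :=
  (exists_wordProd_autInversionSet_eq hc hN).imp' _ fun _ h => h.2

/-! ### The length is the number of inversions -/

theorem ncard_autInversionSet_wordProd_le (l : List b.support) :
    (autInversionSet b (wordProd b l : P.Aut)).ncard ≤ l.length := by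
  induction l with
  | nil =>
    have h : autInversionSet b (wordProd b [] : P.Aut) = ∅ := autInversionSet_one b
    simp [h]
  | cons i t ih =>
    have hsub : autInversionSet b (wordProd b (i :: t) : P.Aut) ⊆
        insert ((wordProd b t : P.Aut)⁻¹ • (i : ι)) (autInversionSet b (wordProd b t : P.Aut)) := by
      rintro j ⟨hj, hn⟩
      rw [wordProd_cons] at hn
      by_contra hc
      rw [Set.mem_insert_iff, not_or] at hc
      have hp : b.IsPos ((wordProd b t : P.Aut) • j) := by
        by_contra h
        exact hc.2 ⟨hj, h⟩
      have hn' : ¬ b.IsPos (RootPairing.Equiv.reflection P (i : ι) • (wordProd b t : P.Aut) • j) := by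
        rw [← mul_smul]; exact hn
      refine hn' (isPos_reflection_smul hp i.2 fun h => hc.1 ?_)
      rw [← h, inv_smul_smul]
    calc _ ≤ _ := Set.ncard_le_ncard hsub (Set.toFinite _)
      _ ≤ _ := Set.ncard_insert_le _ _
      _ ≤ _ := by simpa using ih

theorem weylLength_eq_ncard [P.IsRootSystem] (x : P.weylGroup) :
    weylLength b x = (autInversionSet b (x : P.Aut)).ncard := by
  apply le_antisymm
  · obtain ⟨l, hl, e⟩ := exists_wordProd_autInversionSet_eq (isSumClosed_autInversionSet b x.1)
      (isCoclosed_autInversionSet b x.1)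
    exact Nat.sInf_le ⟨l, hl, weyl_eq_of_autInversionSet_eq e⟩
  · obtain ⟨l₀, h₀⟩ := exists_wordProd_eq b x
    obtain ⟨l, hl, e⟩ := Nat.sInf_mem (s := {n | ∃ l : List b.support, l.length = n ∧
      (l.map fun i => RootPairing.weylGroup.ofIdx P (i : ι)).prod = x}) ⟨_, l₀, rfl, h₀⟩
    unfold weylLength
    rw [← hl]
    have e' : wordProd b l = x := e
    have := ncard_autInversionSet_wordProd_le l
    rwa [e'] at this

end

/-! ### Twisted Weyl groups -/

section

variable {Ω : Subgroup P.Aut} {b : P.Base}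

theorem toAut_eq (w : TwistedWeylGroup P Ω) :
    toAut w = (w.left : P.Aut) * (w.right : P.Aut) := rfl

theorem toAut_ofWeyl (x : P.weylGroup) : toAut (ofWeyl (Ω := Ω) x) = (x : P.Aut) := by
  simp [toAut, ofWeyl]

theorem inversionSet_ofWeyl (x : P.weylGroup) :
    inversionSet b (ofWeyl (Ω := Ω) x) = autInversionSet b (x : P.Aut) := by
  rw [inversionSet_eq_autInversionSet, toAut_ofWeyl]

theorem toAut_mul_smul (x y : TwistedWeylGroup P Ω) (i : ι) :
    toAut (x * y) • i = toAut x • toAut y • i := by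
  rw [map_mul, mul_smul]

variable [Finite ι] [P.IsCrystallographic]

theorem isPos_twist_smul (hΩ : Ω ≤ twists b) {d : P.Aut} (hd : d ∈ Ω) {i : ι}
    (hi : b.IsPos i) : b.IsPos (d • i) := by
  have hst : ∀ j ∈ b.support, d • j ∈ b.support := by
    intro j hj
    have h : d • (b.support : Set ι) = b.support := MulAction.mem_stabilizer_iff.mp (hΩ hd)
    have h' : d • j ∈ d • (b.support : Set ι) := Set.smul_mem_smul_set hj
    rw [h] at h'
    exact h'
  refine hi.induction_on_add (p := fun i => b.IsPos (d • i)) (fun j hj => ?_) ?_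
  · exact RootPairing.Base.isPos_of_mem_support (hst j hj)
  · intro i j k e h hj
    exact h.add (RootPairing.Base.isPos_of_mem_support (hst j hj)) (root_smul_add d e)

theorem isPos_twist_smul_iff (hΩ : Ω ≤ twists b) {d : P.Aut} (hd : d ∈ Ω) {i : ι} :
    b.IsPos (d • i) ↔ b.IsPos i := by
  refine ⟨fun h => ?_, isPos_twist_smul hΩ hd⟩
  have := isPos_twist_smul hΩ (inv_mem hd) h
  rwa [inv_smul_smul] at this

variable [P.IsRootSystem] [P.IsReduced]

theorem length_eq_ncard (hΩ : Ω ≤ twists b) (w : TwistedWeylGroup P Ω) :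
    length b w = (inversionSet b w).ncard := by
  rw [length, weylLength_eq_ncard]
  have h : autInversionSet b (w.left : P.Aut) = ((w.right : P.Aut) • ·) '' inversionSet b w := by
    ext i
    constructor
    · rintro ⟨hi, hn⟩
      refine ⟨(w.right : P.Aut)⁻¹ • i, ⟨?_, ?_⟩, smul_inv_smul _ _⟩
      · exact (isPos_twist_smul_iff hΩ (inv_mem w.right.2)).mpr hi
      · rw [toAut_eq, mul_smul, smul_inv_smul]
        exact hn
    · rintro ⟨j, ⟨hj, hn⟩, rfl⟩
      refine ⟨(isPos_twist_smul_iff hΩ w.right.2).mpr hj, ?_⟩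
      rwa [toAut_eq, mul_smul] at hn
  rw [h, Set.ncard_image_of_injective _ (MulAction.injective _)]

/-- The action of `y` embeds the inversions of `x * y` not inverted by `y` into those of `x`;
counting forces the inclusion when lengths add, and the inclusion makes the embedding onto. -/
theorem length_mul_iff (hΩ : Ω ≤ twists b) (x y : TwistedWeylGroup P Ω) :
    length b (x * y) = length b x + length b y ↔ inversionSet b y ⊆ inversionSet b (x * y) := by
  rw [length_eq_ncard hΩ, length_eq_ncard hΩ, length_eq_ncard hΩ]
  set I := inversionSet b (x * y)
  set J := inversionSet b y
  have hsub : (toAut y • ·) '' (I \ J) ⊆ inversionSet b x := by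
    rintro _ ⟨i, ⟨⟨hi, hn⟩, hJ⟩, rfl⟩
    refine ⟨?_, ?_⟩
    · by_contra h
      exact hJ ⟨hi, h⟩
    · rwa [toAut_mul_smul] at hn
  have hcard : ((toAut y • ·) '' (I \ J)).ncard = (I \ J).ncard :=
    Set.ncard_image_of_injective _ (MulAction.injective _)
  constructor
  · intro h
    have h₁ := Set.ncard_le_ncard hsub (Set.toFinite _)
    have h₂ := Set.ncard_inter_add_ncard_sdiff_eq_ncard I J (Set.toFinite _)
    have h₃ : I ∩ J = J :=
      Set.eq_of_subset_of_ncard_le Set.inter_subset_right (by omega) (Set.toFinite _)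
    exact Set.inter_eq_right.mp h₃
  · intro h
    have himg : (toAut y • ·) '' (I \ J) = inversionSet b x := by
      refine subset_antisymm hsub ?_
      rintro i ⟨hi, hn⟩
      -- Otherwise `-y⁻¹ i` is inverted by `y`, hence by `x * y`, which however sends it to the
      -- positive root `-x i`.
      have hp : b.IsPos ((toAut y)⁻¹ • i) := by
        by_contra hc
        obtain ⟨j, hj⟩ := exists_root_eq_neg P ((toAut y)⁻¹ • i)
        have hyj := root_smul_neg (toAut y) hj
        rw [smul_inv_smul] at hyj
        have hjJ : j ∈ J :=
          ⟨(isPos_iff_not_of_neg hj).mpr hc, by rwa [isPos_iff_not_of_neg hyj, not_not]⟩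
        have hjI := (h hjJ).2
        rw [toAut_mul_smul, isPos_iff_not_of_neg (root_smul_neg (toAut x) hyj)] at hjI
        exact hjI hn
      refine ⟨(toAut y)⁻¹ • i, ⟨⟨hp, ?_⟩, fun hJ => hJ.2 ?_⟩, smul_inv_smul _ _⟩
      · rwa [toAut_mul_smul, smul_inv_smul]
      · rwa [smul_inv_smul]
    rw [← himg, hcard, Set.ncard_sdiff_add_ncard_of_subset h (Set.toFinite _)]

theorem weakLE_iff (hΩ : Ω ≤ twists b) (y z : TwistedWeylGroup P Ω) :
    WeakLE b y z ↔ inversionSet b y ⊆ inversionSet b z := by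
  constructor
  · rintro ⟨x, rfl, h⟩
    exact (length_mul_iff hΩ x y).mp h
  · intro h
    have e : z * y⁻¹ * y = z := inv_mul_cancel_right z y
    refine ⟨z * y⁻¹, e.symm, ?_⟩
    have := (length_mul_iff hΩ (z * y⁻¹) y).mpr (by rwa [e])
    rwa [e] at this

theorem ofWeyl_inj_of_inversionSet_eq {x y : P.weylGroup}
    (h : inversionSet b (ofWeyl (Ω := Ω) x) = inversionSet b (ofWeyl (Ω := Ω) y)) : x = y := by
  rw [inversionSet_ofWeyl, inversionSet_ofWeyl] at h
  exact weyl_eq_of_autInversionSet_eq h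

end

/-! ### Root paths -/

/-- `η` is reached from `β` by successively adding elements of `K`, all partial sums being roots. -/
def Reach (P : RootPairing ι ℝ V V') (K : Set ι) : ι → ι → Prop :=
  Relation.ReflTransGen fun i j => ∃ k ∈ K, P.root j = P.root i + P.root k

theorem Reach.mono {K L : Set ι} (h : K ⊆ L) {β η : ι} (hr : Reach P K β η) : Reach P L β η :=
  Relation.ReflTransGen.mono (fun _ _ ⟨k, hk, e⟩ => ⟨k, h hk, e⟩) _ _ hr

theorem Reach.smul {K L : Set ι} (g : P.Aut) (h : ∀ k ∈ K, g • k ∈ L) {β η : ι}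
    (hr : Reach P K β η) : Reach P L (g • β) (g • η) :=
  Relation.ReflTransGen.lift (g • ·)
    (fun _ _ ⟨k, hk, e⟩ => ⟨g • k, h k hk, root_smul_add g e⟩) _ _ hr

theorem Reach.isPos {b : P.Base} {K : Set ι} (hK : K ⊆ posRoots b) {β η : ι} (hβ : b.IsPos β)
    (hr : Reach P K β η) : b.IsPos η := by
  induction hr with
  | refl => exact hβ
  | tail _ h ih =>
    obtain ⟨k, hk, e⟩ := h
    exact ih.add (hK hk) e

theorem Reach.exists_list {K : Set ι} {β η : ι} (hr : Reach P K β η) :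
    ∃ l : List ι, (∀ i ∈ l, i ∈ K) ∧ P.root η = P.root β + (l.map P.root).sum := by
  induction hr with
  | refl => exact ⟨[], by simp, by simp⟩
  | tail _ h ih =>
    obtain ⟨k, hk, e⟩ := h
    obtain ⟨l, hl, e'⟩ := ih
    refine ⟨k :: l, by simpa using ⟨hk, hl⟩, ?_⟩
    rw [e, e', List.map_cons, List.sum_cons]
    abel

theorem exists_pos_of_sum_pos (f : V →ₗ[ℝ] ℝ) {l : List ι} (h : 0 < f (l.map P.root).sum) :
    ∃ i ∈ l, 0 < f (P.root i) := by
  induction l with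
  | nil => simp at h
  | cons k l ih =>
    rw [List.map_cons, List.sum_cons, map_add] at h
    rcases lt_or_ge 0 (f (P.root k)) with hk | hk
    · exact ⟨k, by simp, hk⟩
    · obtain ⟨i, hi, h'⟩ := ih (by linarith)
      exact ⟨i, List.mem_cons_of_mem _ hi, h'⟩

section

variable [P.IsRootSystem] {b : P.Base}

theorem heightFunctional_sum_nonneg {l : List ι} (hl : ∀ i ∈ l, b.IsPos i) :
    0 ≤ heightFunctional b (l.map P.root).sum := by
  rw [map_list_sum, List.map_map]
  refine List.sum_nonneg ?_
  simp only [List.mem_map]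
  rintro _ ⟨i, hi, rfl⟩
  exact ((isPos_iff_heightFunctional b).mp (hl i hi)).le

variable [Finite ι] [P.IsCrystallographic]

/-- If a root is obtained from a positive root by adding positive roots, then these can be added in
such an order that all partial sums are roots. -/
theorem reach_of_list {K : Set ι} (hK : K ⊆ posRoots b) {β η : ι} (hβ : b.IsPos β) {l : List ι}
    (hl : ∀ i ∈ l, i ∈ K) (h : P.root η = P.root β + (l.map P.root).sum) : Reach P K β η := by
  classical
  obtain ⟨B, hB, hpos, hsub⟩ := exists_form P
  induction hn : l.length generalizing l β η with
  | zero =>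
    rw [List.length_eq_zero_iff] at hn
    subst hn
    rw [List.map_nil, List.sum_nil, add_zero] at h
    rw [root_injective P h]
    exact .refl
  | succ n ih =>
    have herase {k : ι} (hk : k ∈ l) :
        (l.map P.root).sum = P.root k + ((l.erase k).map P.root).sum := by
      rw [← List.sum_cons, ← List.map_cons]
      exact ((List.perm_cons_erase hk).map P.root).sum_eq
    have hlen {k : ι} (hk : k ∈ l) : (l.erase k).length = n := by
      rw [List.length_erase_of_mem hk, hn]; rfl
    have hmem {k : ι} : ∀ i ∈ l.erase k, i ∈ K := fun i hi => hl i (List.mem_of_mem_erase hi)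
    have hS : (l.map P.root).sum ≠ 0 := by
      intro h0
      obtain ⟨k, hk⟩ := List.exists_mem_of_length_pos (l := l) (by omega)
      have h₁ := congrArg (heightFunctional b) (h0.symm.trans (herase hk))
      have h₂ := heightFunctional_sum_nonneg (b := b) fun i hi => hK (hmem (k := k) i hi)
      have h₃ := (isPos_iff_heightFunctional b).mp (hK (hl k hk))
      rw [map_zero, map_add] at h₁
      linarith
    -- Since `B(η - β, η - β) > 0`, some summand has `B(η, k) > B(β, k)`. It is added last if `B(η,
    -- k) > 0`; otherwise `B(β, k) < 0` and it is added first.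
    obtain ⟨k, hk, hk'⟩ := exists_pos_of_sum_pos (P := P) (B (P.root η) - B (P.root β)) (l := l) (by
      have h₁ := hpos _ hS
      rw [← map_sub, show P.root η - P.root β = (l.map P.root).sum by rw [h]; abel]
      exact h₁)
    have hkp := hK (hl k hk)
    rw [LinearMap.sub_apply] at hk'
    rcases lt_or_ge 0 (B (P.root η) (P.root k)) with hη | hη
    · have hη' : P.root η - P.root k = P.root β + ((l.erase k).map P.root).sum := by
        rw [h, herase hk]; abel
      obtain ⟨ζ, hζ⟩ := hsub η k hη fun e => by
        have h₁ := congrArg (heightFunctional b) hη'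
        have h₂ := heightFunctional_sum_nonneg (b := b) fun i hi => hK (hmem (k := k) i hi)
        have h₃ := (isPos_iff_heightFunctional b).mp hβ
        rw [e, sub_self, map_zero, map_add] at h₁
        linarith
      exact (ih hβ hmem (hζ.trans hη') (hlen hk)).tail ⟨k, hl k hk, by rw [hζ]; abel⟩
    · obtain ⟨k', hk'n⟩ := exists_root_eq_neg P k
      obtain ⟨ζ, hζ⟩ := hsub β k' (by rw [hk'n, map_neg]; linarith) fun e =>
        add_ne_zero_of_isPos hβ hkp (by rw [e, hk'n]; abel)
      have hζ' : P.root ζ = P.root β + P.root k := by rw [hζ, hk'n]; abel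
      refine .head ⟨k, hl k hk, hζ'⟩ (ih (hβ.add hkp hζ') hmem ?_ (hlen hk))
      rw [h, hζ', herase hk]; abel

/-- Steps in `K ∪ L` can be reordered so that those in `K` come first. -/
theorem Reach.exists_of_union {K L : Set ι} (hK : K ⊆ posRoots b) (hL : L ⊆ posRoots b)
    (hKL : ∀ i ∈ L, ∀ j ∈ K, ∀ k, P.root k = P.root i + P.root j → k ∈ K ∪ L) {β η : ι}
    (hβ : b.IsPos β) (hr : Reach P (K ∪ L) β η) : ∃ ζ, Reach P K β ζ ∧ Reach P L ζ η := by
  -- Moves one `L`-step `ε` past a path in `K`. At each `K`-step `γ`, either the two steps swap, or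
  -- `ε + γ` is a root and they merge into a single step in `K ∪ L`.
  have push {β' ζ : ι} (h₁ : Reach P K β' ζ) (h₂ : Reach P L ζ η) : ∀ β ε, b.IsPos β → ε ∈ L →
      P.root β' = P.root β + P.root ε → ∃ ζ', Reach P K β ζ' ∧ Reach P L ζ' η := by
    induction h₁ using Relation.ReflTransGen.head_induction_on with
    | refl => exact fun β ε _ hε e => ⟨β, .refl, .head ⟨ε, hε, e⟩ h₂⟩
    | @head β' β'' hstep hrest ih =>
      intro β ε hβ hε e
      obtain ⟨γ, hγ, e'⟩ := hstep
      rw [e] at e'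
      rcases exists_root_add_of_root_add_add e' (add_ne_zero_of_isPos hβ (hL hε))
        (add_ne_zero_of_isPos hβ (hK hγ)) (add_ne_zero_of_isPos (hL hε) (hK hγ)) with
        ⟨m, hm⟩ | ⟨m, hm⟩
      · obtain ⟨ζ', h₃, h₄⟩ := ih m ε (hβ.add (hK hγ) hm) hε (by rw [e', hm]; abel)
        exact ⟨ζ', .head ⟨γ, hγ, hm⟩ h₃, h₄⟩
      · have e'' : P.root β'' = P.root β + P.root m := by rw [e', hm]; abel
        rcases hKL ε hε γ hγ m hm with hmK | hmL
        · exact ⟨ζ, .head ⟨m, hmK, e''⟩ hrest, h₂⟩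
        · exact ih β m hβ hmL e''
  induction hr using Relation.ReflTransGen.head_induction_on with
  | refl => exact ⟨η, .refl, .refl⟩
  | head hstep _ ih =>
    obtain ⟨k, hk, e⟩ := hstep
    have hkp : b.IsPos k := hk.elim (fun h => hK h) fun h => hL h
    obtain ⟨ζ, h₁, h₂⟩ := ih (hβ.add hkp e)
    rcases hk with hk | hk
    · exact ⟨ζ, .head ⟨k, hk, e⟩ h₁, h₂⟩
    · exact push h₁ h₂ _ k hβ hk e

/-- A path starting at a sum of two positive roots is the sum of paths starting at the summands. -/
theorem Reach.exists_add {K : Set ι} (hK : K ⊆ posRoots b) {β₁ β₂ β η : ι} (h₁ : b.IsPos β₁)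
    (h₂ : b.IsPos β₂) (h : P.root β = P.root β₁ + P.root β₂) (hr : Reach P K β η) :
    ∃ η₁ η₂, Reach P K β₁ η₁ ∧ Reach P K β₂ η₂ ∧ P.root η = P.root η₁ + P.root η₂ := by
  induction hr with
  | refl => exact ⟨β₁, β₂, .refl, .refl, h⟩
  | tail _ hstep ih =>
    obtain ⟨k, hk, e⟩ := hstep
    obtain ⟨η₁, η₂, hr₁, hr₂, e'⟩ := ih
    rw [e'] at e
    have p₁ := hr₁.isPos hK h₁
    have p₂ := hr₂.isPos hK h₂
    rcases exists_root_add_of_root_add_add e (add_ne_zero_of_isPos p₁ p₂)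
      (add_ne_zero_of_isPos p₁ (hK hk)) (add_ne_zero_of_isPos p₂ (hK hk)) with ⟨m, hm⟩ | ⟨m, hm⟩
    · exact ⟨m, η₂, hr₁.tail ⟨k, hk, hm⟩, hr₂, by rw [e, hm]; abel⟩
    · exact ⟨η₁, m, hr₁, hr₂.tail ⟨k, hk, hm⟩, by rw [e, hm]; abel⟩

end

/-! ### The crossing map -/

section

variable {Ω : Subgroup P.Aut} {b : P.Base}

theorem inversionSet_subset_posRoots (w : TwistedWeylGroup P Ω) :
    inversionSet b w ⊆ posRoots b := fun _ h => h.1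

theorem cross_subset_posRoots (w : TwistedWeylGroup P Ω) (N : Set ι) :
    cross b w N ⊆ posRoots b := by
  intro γ hγ
  obtain ⟨β, -, h⟩ := Set.mem_iUnion₂.mp hγ
  exact h.1

theorem cross_mono (w : TwistedWeylGroup P Ω) : Monotone (cross b w) :=
  fun _ _ h => Set.biUnion_subset_biUnion_left h

theorem cross_union (w : TwistedWeylGroup P Ω) (N M : Set ι) :
    cross b w (N ∪ M) = cross b w N ∪ cross b w M :=
  Set.biUnion_union _ _ _

theorem cross_iterate_subset_posRoots (w : TwistedWeylGroup P Ω) {N : Set ι}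
    (hN : N ⊆ posRoots b) (d : ℕ) : (cross b w)^[d] N ⊆ posRoots b := by
  cases d with
  | zero => exact hN
  | succ d =>
    rw [Function.iterate_succ_apply']
    exact cross_subset_posRoots w _

theorem cross_one {N : Set ι} (hN : N ⊆ posRoots b) :
    cross b (1 : TwistedWeylGroup P Ω) N = N := by
  have hK : inversionSet b (1 : TwistedWeylGroup P Ω) = ∅ := by
    rw [inversionSet_eq_autInversionSet, map_one, autInversionSet_one]
  ext γ
  constructor
  · intro h
    obtain ⟨β, hβ, -, l, hl, e⟩ := Set.mem_iUnion₂.mp h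
    rw [hK] at hl
    rw [List.eq_nil_iff_forall_not_mem.mpr fun i hi => hl i hi, map_one, one_smul] at e
    rw [root_injective P (by simpa using e : P.root γ = P.root β)]
    exact hβ
  · intro h
    exact Set.mem_biUnion h ⟨hN h, [], by simp, by simp⟩

theorem smul_mem_cross (w : TwistedWeylGroup P Ω) {N : Set ι} {β : ι} (hβ : β ∈ N)
    (h : b.IsPos (toAut w • β)) : toAut w • β ∈ cross b w N :=
  Set.mem_biUnion hβ ⟨h, [], by simp, by simp [root_smul]⟩

variable [Finite ι] [P.IsRootSystem] [P.IsCrystallographic]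

/-- Replaces arbitrary sums by root paths, which permit induction on single steps. -/
theorem mem_crossRoot_iff (w : TwistedWeylGroup P Ω) {β γ : ι} (hβ : b.IsPos β) :
    γ ∈ crossRoot b w β ↔
      b.IsPos γ ∧ ∃ η, toAut w • η = γ ∧ Reach P (inversionSet b w) β η := by
  constructor
  · rintro ⟨hγ, l, hl, e⟩
    refine ⟨hγ, (toAut w)⁻¹ • γ, smul_inv_smul _ _, ?_⟩
    refine reach_of_list (inversionSet_subset_posRoots w) hβ hl ?_
    rw [root_smul, e, inv_smul_smul]
  · rintro ⟨hγ, η, rfl, hr⟩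
    obtain ⟨l, hl, e⟩ := hr.exists_list
    exact ⟨hγ, l, hl, by rw [root_smul, e]⟩

theorem cross_inversionSet_self (w : TwistedWeylGroup P Ω) :
    cross b w (inversionSet b w) = ∅ := by
  rw [Set.eq_empty_iff_forall_notMem]
  intro γ hγ
  obtain ⟨β, hβ, h⟩ := Set.mem_iUnion₂.mp hγ
  obtain ⟨hγp, η, rfl, hr⟩ := (mem_crossRoot_iff w hβ.1).mp h
  have : ¬ b.IsPos (toAut w • η) := by
    clear h hγ hγp
    induction hr with
    | refl => exact hβ.2
    | tail _ hstep ih =>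
      obtain ⟨k, hk, e⟩ := hstep
      exact not_isPos_add ih hk.2 (root_smul_add _ e)
  exact this hγp

/-- A path from `i + j` splits into paths from `i` to `η₁` and from `j` to `η₂`. If `w` keeps both
ends positive, the crossed root is their sum. If it makes one negative, that end is an inversion of
`w`, hence a legitimate last step for the other path. -/
theorem cross_sumClosure_subset (w : TwistedWeylGroup P Ω) {N : Set ι} (hN : N ⊆ posRoots b) :
    cross b w (sumClosure P N) ⊆ sumClosure P (cross b w N) := by
  intro γ hγ
  obtain ⟨β, hβ, h⟩ := Set.mem_iUnion₂.mp hγ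
  have hβp := sumClosure_subset_posRoots hN hβ
  obtain ⟨hγp, η, rfl, hr⟩ := (mem_crossRoot_iff w hβp).mp h
  clear h hγ hβp
  induction hβ generalizing η with
  | base hβ =>
    exact .base (Set.mem_biUnion hβ ((mem_crossRoot_iff w (hN hβ)).mpr ⟨hγp, η, rfl, hr⟩))
  | @add i j k hi hj e ihi ihj =>
    have hip := sumClosure_subset_posRoots hN hi
    have hjp := sumClosure_subset_posRoots hN hj
    have hK := inversionSet_subset_posRoots (b := b) w
    obtain ⟨η₁, η₂, hr₁, hr₂, e'⟩ := hr.exists_add hK hip hjp e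
    by_cases p₁ : b.IsPos (toAut w • η₁)
    · by_cases p₂ : b.IsPos (toAut w • η₂)
      · exact .add (ihi _ hr₁ p₁) (ihj _ hr₂ p₂) (root_smul_add _ e')
      · exact ihi _ (hr₁.tail ⟨η₂, ⟨hr₂.isPos hK hjp, p₂⟩, e'⟩) hγp
    · exact ihj _ (hr₂.tail ⟨η₁, ⟨hr₁.isPos hK hip, p₁⟩, by rw [e', add_comm]⟩) hγp

theorem cross_iterate_sumClosure_subset (w : TwistedWeylGroup P Ω) {N : Set ι}
    (hN : N ⊆ posRoots b) (d : ℕ) :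
    (cross b w)^[d] (sumClosure P N) ⊆ sumClosure P ((cross b w)^[d] N) := by
  induction d with
  | zero => exact subset_rfl
  | succ d ih =>
    rw [Function.iterate_succ_apply', Function.iterate_succ_apply']
    exact (cross_mono w ih).trans
      (cross_sumClosure_subset w (cross_iterate_subset_posRoots w hN d))

/-- The inversions of `x * y` are those of `y` and the preimages under `y` of those of `x`. A path
through them can be reordered to use the former first, which is crossing `y` before `x`. -/
theorem crossRoot_mul {x y : TwistedWeylGroup P Ω}
    (hxy : inversionSet b y ⊆ inversionSet b (x * y)) {β : ι} (hβ : b.IsPos β) :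
    crossRoot b (x * y) β = cross b x (crossRoot b y β) := by
  set K := inversionSet b y
  set L := ((toAut y)⁻¹ • ·) '' inversionSet b x with hL
  have hLp : L ⊆ posRoots b := by
    rintro _ ⟨i, ⟨hi, hn⟩, rfl⟩
    by_contra hc
    obtain ⟨j, hj⟩ := exists_root_eq_neg P ((toAut y)⁻¹ • i)
    have hyj := root_smul_neg (toAut y) hj
    rw [smul_inv_smul] at hyj
    have hjK : j ∈ K :=
      ⟨(isPos_iff_not_of_neg hj).mpr hc, by rwa [isPos_iff_not_of_neg hyj, not_not]⟩
    have h := (hxy hjK).2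
    rw [toAut_mul_smul, isPos_iff_not_of_neg (root_smul_neg (toAut x) hyj)] at h
    exact h hn
  have hLsub : L ⊆ inversionSet b (x * y) := by
    rintro _ ⟨i, hi, rfl⟩
    refine ⟨hLp ⟨i, hi, rfl⟩, ?_⟩
    rw [toAut_mul_smul, smul_inv_smul]
    exact hi.2
  have hunion : inversionSet b (x * y) = K ∪ L := by
    refine subset_antisymm (fun i hi => ?_) (Set.union_subset hxy hLsub)
    by_cases h : b.IsPos (toAut y • i)
    · refine .inr ⟨toAut y • i, ⟨h, ?_⟩, inv_smul_smul _ _⟩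
      rw [← toAut_mul_smul]
      exact hi.2
    · exact .inl ⟨hi.1, h⟩
  have hKp : K ⊆ posRoots b := inversionSet_subset_posRoots y
  ext γ
  rw [mem_crossRoot_iff _ hβ]
  constructor
  · rintro ⟨hγ, η, rfl, hr⟩
    rw [hunion] at hr
    obtain ⟨ζ, h₁, h₂⟩ := hr.exists_of_union hKp hLp (fun i hi j hj k e => by
      rw [← hunion]
      exact isSumClosed_autInversionSet b (toAut (x * y)) i (hLsub hi) j (hxy hj) k e) hβ
    have hyL : ∀ k ∈ L, toAut y • k ∈ inversionSet b x := by
      rintro _ ⟨i, hi, rfl⟩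
      rwa [smul_inv_smul]
    have h₃ := h₂.smul (toAut y) hyL
    -- Otherwise `x * y` inverts `ζ`, and the remaining steps, all inverted too, keep the image
    -- negative up to the end.
    have hζ : b.IsPos (toAut y • ζ) := by
      by_contra hc
      have hζp := h₁.isPos hKp hβ
      have hxyζ : ¬ b.IsPos (toAut (x * y) • ζ) := (hxy ⟨hζp, hc⟩).2
      have : ¬ b.IsPos (toAut (x * y) • η) := by
        clear hγ hr h₃
        induction h₂ with
        | refl => exact hxyζ
        | tail _ hstep ih =>
          obtain ⟨k, hk, e⟩ := hstep
          exact not_isPos_add ih (hLsub hk).2 (root_smul_add _ e)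
      exact this hγ
    refine Set.mem_biUnion ((mem_crossRoot_iff y hβ).mpr ⟨hζ, ζ, rfl, h₁⟩) ?_
    exact (mem_crossRoot_iff x hζ).mpr ⟨hγ, toAut y • η, (toAut_mul_smul x y η).symm, h₃⟩
  · intro h
    obtain ⟨δ, hδ, h⟩ := Set.mem_iUnion₂.mp h
    obtain ⟨hδp, ζ, rfl, h₁⟩ := (mem_crossRoot_iff y hβ).mp hδ
    obtain ⟨hγ, ξ, rfl, h₂⟩ := (mem_crossRoot_iff x hδp).mp h
    refine ⟨hγ, (toAut y)⁻¹ • ξ, by rw [toAut_mul_smul, smul_inv_smul], ?_⟩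
    have h₃ := h₂.smul (L := L) (toAut y)⁻¹ fun k hk => ⟨k, hk, rfl⟩
    rw [inv_smul_smul] at h₃
    exact (h₁.mono hxy).trans (h₃.mono hLsub)

theorem cross_mul {x y : TwistedWeylGroup P Ω}
    (hxy : inversionSet b y ⊆ inversionSet b (x * y)) {N : Set ι} (hN : N ⊆ posRoots b) :
    cross b (x * y) N = cross b x (cross b y N) := by
  ext γ
  simp only [cross, Set.mem_iUnion, exists_prop]
  constructor
  · rintro ⟨β, hβ, h⟩
    rw [crossRoot_mul hxy (hN hβ)] at h
    obtain ⟨δ, hδ, h⟩ := Set.mem_iUnion₂.mp h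
    exact ⟨δ, ⟨β, hβ, hδ⟩, h⟩
  · rintro ⟨δ, ⟨β, hβ, hδ⟩, h⟩
    refine ⟨β, hβ, ?_⟩
    rw [crossRoot_mul hxy (hN hβ)]
    exact Set.mem_biUnion hδ h

end

/-! ### Right factors of powers of reduced braids -/

section

variable {Ω : Subgroup P.Aut} {b : P.Base}

theorem braid_one : braid b (1 : TwistedWeylGroup P Ω) = 1 :=
  PresentedMonoid.mk_eq_mk_of_rel .one

theorem braid_mul {x y : TwistedWeylGroup P Ω} (h : length b (x * y) = length b x + length b y) :
    braid b x * braid b y = braid b (x * y) :=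
  PresentedMonoid.mk_eq_mk_of_rel (.mul x y h)

theorem isCoclosed_inversionSet (w : TwistedWeylGroup P Ω) : IsCoclosed b (inversionSet b w) :=
  isCoclosed_autInversionSet b _

theorem isPos_zpow_of_mem_stableRoots {w : TwistedWeylGroup P Ω} {i : ι} (hi : b.IsPos i)
    (h : i ∈ stableRoots b w) (n : ℤ) : b.IsPos (toAut (w ^ n) • i) := by
  rcases h with h | h
  · exact h n
  · exact (h 0 (by simpa using hi)).elim

/-- The set of non-stable positive roots is co-closed. -/
theorem isCoclosed_nonstable (w : TwistedWeylGroup P Ω) :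
    IsCoclosed b (posRoots b \ stableRoots b w) := by
  refine ⟨Set.sdiff_subset, fun k hk i j hi hj e => ?_⟩
  by_contra! hn
  have h₁ : i ∈ stableRoots b w := by by_contra h; exact hn.1 ⟨hi, h⟩
  have h₂ : j ∈ stableRoots b w := by by_contra h; exact hn.2 ⟨hj, h⟩
  exact hk.2 (.inl fun n => (isPos_zpow_of_mem_stableRoots hi h₁ n).add
    (isPos_zpow_of_mem_stableRoots hj h₂ n) (root_smul_add _ e))

/-- Crossing with no added roots follows the orbit of a stable root, so such a root is never
annihilated. -/
theorem smul_mem_cross_iterate {w : TwistedWeylGroup P Ω} {N : Set ι} {i : ι} (hN : i ∈ N)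
    (hi : b.IsPos i) (h : i ∈ stableRoots b w) (d : ℕ) :
    toAut (w ^ d) • i ∈ (cross b w)^[d] N := by
  induction d with
  | zero => simpa using hN
  | succ d ih =>
    have hp := isPos_zpow_of_mem_stableRoots hi h (d + 1 : ℕ)
    rw [zpow_natCast, pow_succ', toAut_mul_smul] at hp
    rw [Function.iterate_succ_apply', pow_succ', toAut_mul_smul]
    exact smul_mem_cross w ih hp

/-- Every set of positive roots annihilated by crossing is contained in the
set of non-stable roots. -/
theorem subset_nonstable_of_cross_iterate_eq_empty {w : TwistedWeylGroup P Ω} {N : Set ι} {d : ℕ}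
    (hN : N ⊆ posRoots b) (h : (cross b w)^[d] N = ∅) :
    N ⊆ posRoots b \ stableRoots b w := fun i hi => by
  refine ⟨hN hi, fun hs => ?_⟩
  have h' := smul_mem_cross_iterate hi (hN hi) hs d
  rw [h] at h'
  exact h'

theorem cross_iterate_union (w : TwistedWeylGroup P Ω) (N M : Set ι) (d : ℕ) :
    (cross b w)^[d] (N ∪ M) = (cross b w)^[d] N ∪ (cross b w)^[d] M := by
  induction d generalizing N M with
  | zero => rfl
  | succ d ih => simp only [Function.iterate_succ_apply, cross_union, ih]

theorem IsConvex.isSumClosed {w : TwistedWeylGroup P Ω} (h : IsConvex b w) :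
    IsSumClosed P (posRoots b \ stableRoots b w) := fun i hi j hj k e =>
  h i hi j hj 1 1 one_pos one_pos k (by rw [e, one_smul, one_smul])

theorem image_val_preimage_val {N : Set ι} (hN : N ⊆ posRoots b) :
    Subtype.val '' (Subtype.val ⁻¹' N : Set {i // b.IsPos i}) = N :=
  Set.image_preimage_eq_of_subset fun i hi => ⟨⟨i, hN hi⟩, rfl⟩

theorem image_val_subset_posRoots (N : Set {i // b.IsPos i}) : Subtype.val '' N ⊆ posRoots b := by
  rintro _ ⟨i, -, rfl⟩
  exact i.2

variable [Finite ι] [P.IsRootSystem] [P.IsCrystallographic]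

theorem cross_iterate_sumClosure_eq_empty {w : TwistedWeylGroup P Ω} {N : Set ι} {d : ℕ}
    (hN : N ⊆ posRoots b) (h : (cross b w)^[d] N = ∅) : (cross b w)^[d] (sumClosure P N) = ∅ := by
  have h' := cross_iterate_sumClosure_subset w hN d
  rwa [h, sumClosure_empty, Set.subset_empty_iff] at h'

/-- The sum-closure is annihilated as well, so it contains no stable root and adds nothing. -/
theorem isSumClosed_nonstable {w : TwistedWeylGroup P Ω} {d : ℕ}
    (h : (cross b w)^[d] (posRoots b \ stableRoots b w) = ∅) :
    IsSumClosed P (posRoots b \ stableRoots b w) := by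
  have hN : posRoots b \ stableRoots b w ⊆ posRoots b := Set.sdiff_subset
  have h₁ := subset_nonstable_of_cross_iterate_eq_empty (sumClosure_subset_posRoots hN)
    (cross_iterate_sumClosure_eq_empty hN h)
  rw [subset_antisymm (subset_sumClosure _) h₁]
  exact isSumClosed_sumClosure _

variable [P.IsReduced]

theorem exists_inversionSet_ofWeyl_eq (Ω : Subgroup P.Aut) {N : Set ι} (hc : IsSumClosed P N)
    (hN : IsCoclosed b N) :
    ∃ x : P.weylGroup, inversionSet b (ofWeyl (Ω := Ω) x) = N := by
  obtain ⟨x, hx⟩ := exists_weyl_autInversionSet_eq hc hN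
  exact ⟨x, by rw [inversionSet_ofWeyl, hx]⟩

theorem exists_inversionSet_eq_sumClosure (Ω : Subgroup P.Aut) {N : Set ι}
    (hN : IsCoclosed b N) :
    ∃ x : P.weylGroup, inversionSet b (ofWeyl (Ω := Ω) x) = sumClosure P N :=
  exists_inversionSet_ofWeyl_eq Ω (isSumClosed_sumClosure N) hN.sumClosure

/-! ### Crossing and divisibility in the braid monoid -/

/-- Crossing as a self-map of the sets of positive roots. -/
def crossEnd (b : P.Base) (w : TwistedWeylGroup P Ω) : Function.End (Set {i // b.IsPos i}) :=
  fun N => Subtype.val ⁻¹' cross b w (Subtype.val '' N)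

/-- The action of the braid monoid on sets of positive roots by crossing. -/
def crossHom (hΩ : Ω ≤ twists b) :
    BraidMonoid b Ω →* Function.End (Set {i // b.IsPos i}) :=
  PresentedMonoid.lift (crossEnd b) <| by
    intro u v h
    cases h with
    | one =>
      rw [FreeMonoid.lift_eval_of, map_one]
      funext N
      -- Crossing the identity discards nonpositive roots, so the unit acts trivially only on sets
      -- of positive roots.
      change Subtype.val ⁻¹' cross b 1 (Subtype.val '' N) = N
      rw [cross_one (image_val_subset_posRoots N), Set.preimage_image_eq _ Subtype.val_injective]
    | mul x y h =>
      rw [map_mul, FreeMonoid.lift_eval_of, FreeMonoid.lift_eval_of, FreeMonoid.lift_eval_of]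
      funext N
      change Subtype.val ⁻¹' cross b x (Subtype.val '' (Subtype.val ⁻¹' _)) =
        Subtype.val ⁻¹' cross b (x * y) (Subtype.val '' N)
      rw [cross_mul ((length_mul_iff hΩ x y).mp h) (image_val_subset_posRoots N),
        image_val_preimage_val (cross_subset_posRoots y _)]

theorem crossHom_braid (hΩ : Ω ≤ twists b) (w : TwistedWeylGroup P Ω) {N : Set ι}
    (hN : N ⊆ posRoots b) :
    crossHom hΩ (braid b w) (Subtype.val ⁻¹' N) = Subtype.val ⁻¹' cross b w N := by
  change Subtype.val ⁻¹' cross b w (Subtype.val '' (Subtype.val ⁻¹' N)) = _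
  rw [image_val_preimage_val hN]

theorem crossHom_braid_pow (hΩ : Ω ≤ twists b) (w : TwistedWeylGroup P Ω) {N : Set ι}
    (hN : N ⊆ posRoots b) (d : ℕ) :
    crossHom hΩ (braid b w ^ d) (Subtype.val ⁻¹' N) = Subtype.val ⁻¹' (cross b w)^[d] N := by
  induction d with
  | zero => rw [pow_zero, map_one]; rfl
  | succ d ih =>
    rw [pow_succ', map_mul, Function.iterate_succ_apply',
      ← crossHom_braid hΩ w (cross_iterate_subset_posRoots w hN d), ← ih]
    rfl

theorem crossHom_empty (hΩ : Ω ≤ twists b) (c : BraidMonoid b Ω) : crossHom hΩ c ∅ = ∅ := by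
  obtain ⟨u, rfl⟩ := PresentedMonoid.surjective_mk c
  induction u using FreeMonoid.inductionOn' with
  | one => rw [map_one, map_one]; rfl
  | of_mul w u ih =>
    rw [map_mul, map_mul]
    change crossHom hΩ (braid b w) (crossHom hΩ _ ∅) = ∅
    rw [ih]
    have h := crossHom_braid hΩ w (Set.empty_subset (posRoots b))
    simpa [cross] using h

theorem cross_iterate_eq_empty_of_isRightFactor (hΩ : Ω ≤ twists b) {w w' : TwistedWeylGroup P Ω}
    {d : ℕ} (h : IsRightFactor b (braid b w ^ d) w') :
    (cross b w)^[d] (inversionSet b w') = ∅ := by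
  obtain ⟨c, hc⟩ := h
  have hN := inversionSet_subset_posRoots (b := b) w'
  have h₁ := crossHom_braid_pow hΩ w hN d
  rw [hc, map_mul] at h₁
  change crossHom hΩ c (crossHom hΩ (braid b w') _) = _ at h₁
  rw [crossHom_braid hΩ w' hN, cross_inversionSet_self, Set.preimage_empty, crossHom_empty] at h₁
  rw [← image_val_preimage_val (cross_iterate_subset_posRoots w hN d), ← h₁, Set.image_empty]

/-- Such a `w` inverts nothing, so `b_{w⁻¹}` is a left inverse of `b_w`. -/
theorem isRightFactor_one (hΩ : Ω ≤ twists b) {w : TwistedWeylGroup P Ω}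
    (h : ¬ HasSimple b (inversionSet b w)) : IsRightFactor b 1 w := by
  have hw : inversionSet b w = ∅ := by
    by_contra hne
    exact h (exists_mem_support_of_isCoclosed (isCoclosed_inversionSet w)
      (Set.nonempty_iff_ne_empty.mpr hne))
  refine ⟨braid b w⁻¹, ?_⟩
  rw [braid_mul, inv_mul_cancel, braid_one]
  exact (length_mul_iff hΩ _ _).mpr (by rw [hw]; exact Set.empty_subset _)

/-- If `w' ∨ w = z w`, then the inversions of `z` are sums of elements of `cross_w(R_{w'})`. -/
theorem exists_join (hΩ : Ω ≤ twists b) (w w' : TwistedWeylGroup P Ω) :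
    ∃ z : TwistedWeylGroup P Ω, length b (z * w) = length b z + length b w ∧
      WeakLE b w' (z * w) ∧
      inversionSet b z ⊆ sumClosure P (cross b w (inversionSet b w')) := by
  obtain ⟨x, hx⟩ := exists_inversionSet_eq_sumClosure Ω
    ((isCoclosed_inversionSet (b := b) w).union (isCoclosed_inversionSet w'))
  set u : TwistedWeylGroup P Ω := ofWeyl x
  have hsub : inversionSet b w ∪ inversionSet b w' ⊆ inversionSet b u := by
    rw [hx]; exact subset_sumClosure _
  have hwu := Set.subset_union_left.trans hsub
  have e : u * w⁻¹ * w = u := inv_mul_cancel_right u w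
  refine ⟨u * w⁻¹, (length_mul_iff hΩ _ _).mpr (by rwa [e]), ?_, fun γ hγ => ?_⟩
  · rw [e, weakLE_iff hΩ]
    exact Set.subset_union_right.trans hsub
  · obtain ⟨hγ, hn⟩ := hγ
    have hinv : toAut w⁻¹ = (toAut w)⁻¹ := map_inv _ _
    rw [toAut_mul_smul, hinv] at hn
    have hp : b.IsPos ((toAut w)⁻¹ • γ) := by
      by_contra hc
      obtain ⟨j, hj⟩ := exists_root_eq_neg P ((toAut w)⁻¹ • γ)
      have hwj := root_smul_neg (toAut w) hj
      rw [smul_inv_smul] at hwj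
      have hjw : j ∈ inversionSet b w :=
        ⟨(isPos_iff_not_of_neg hj).mpr hc, by rwa [isPos_iff_not_of_neg hwj, not_not]⟩
      have h := (hwu hjw).2
      rw [isPos_iff_not_of_neg (root_smul_neg (toAut u) hj)] at h
      exact h hn
    have hmem : (toAut w)⁻¹ • γ ∈ inversionSet b u := ⟨hp, hn⟩
    rw [hx] at hmem
    -- The root `γ` is crossed from `w⁻¹ γ`, an inversion of the join, with no roots added.
    have hcr := smul_mem_cross w hmem (by rwa [smul_inv_smul])
    rw [smul_inv_smul] at hcr
    have h := cross_sumClosure_subset w (Set.union_subset (inversionSet_subset_posRoots (b := b) w)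
      (inversionSet_subset_posRoots w')) hcr
    rwa [cross_union, cross_inversionSet_self, Set.empty_union] at h

theorem isRightFactor_of_not_hasSimple (hΩ : Ω ≤ twists b) {w w' : TwistedWeylGroup P Ω}
    {d : ℕ} (h : ¬ HasSimple b ((cross b w)^[d] (inversionSet b w'))) :
    IsRightFactor b (braid b w ^ d) w' := by
  induction d generalizing w' with
  | zero => exact isRightFactor_one hΩ h
  | succ d ih =>
    obtain ⟨z, hz, ⟨v, hv, hv'⟩, hsub⟩ := exists_join hΩ w w'
    have hp := cross_subset_posRoots (b := b) w (inversionSet b w')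
    obtain ⟨c, hc⟩ := ih (w' := z) fun ⟨i, hi, hs⟩ => h <| by
      rw [Function.iterate_succ_apply]
      exact HasSimple.of_sumClosure (cross_iterate_subset_posRoots w hp d)
        ⟨i, cross_iterate_sumClosure_subset w hp d ((cross_mono w).iterate d hsub hi), hs⟩
    refine ⟨c * braid b v, ?_⟩
    rw [hv] at hv'
    rw [pow_succ, hc, mul_assoc, mul_assoc, braid_mul hz, braid_mul hv', hv]

theorem isRightFactor_pow_iff (hΩ : Ω ≤ twists b) {w w' : TwistedWeylGroup P Ω} {d : ℕ} :
    IsRightFactor b (braid b w ^ d) w' ↔ (cross b w)^[d] (inversionSet b w') = ∅ :=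
  ⟨cross_iterate_eq_empty_of_isRightFactor hΩ, fun h =>
    isRightFactor_of_not_hasSimple hΩ (by rw [h]; rintro ⟨i, hi, -⟩; exact hi)⟩

/-- The sum-closure of `N` is an inversion set, and passing to it creates no simple roots in the
iterates, so divisibility of `b_w^d` decides the question. -/
theorem cross_iterate_eq_empty_iff (hΩ : Ω ≤ twists b) (w : TwistedWeylGroup P Ω) {N : Set ι}
    (hN : IsCoclosed b N) (d : ℕ) :
    (cross b w)^[d] N = ∅ ↔ ¬ HasSimple b ((cross b w)^[d] N) := by
  refine ⟨fun h ⟨i, hi, _⟩ => by rwa [h] at hi, fun h => ?_⟩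
  obtain ⟨x, hx⟩ := exists_inversionSet_eq_sumClosure Ω hN
  have h₁ : ¬ HasSimple b ((cross b w)^[d] (inversionSet b (ofWeyl (Ω := Ω) x))) := by
    rintro ⟨i, hi, hs⟩
    rw [hx] at hi
    exact h (HasSimple.of_sumClosure (cross_iterate_subset_posRoots w hN.1 d)
      ⟨i, cross_iterate_sumClosure_subset w hN.1 d hi, hs⟩)
  have h₂ := (isRightFactor_pow_iff hΩ).mp (isRightFactor_of_not_hasSimple hΩ h₁)
  rw [← Set.subset_empty_iff, ← h₂, hx]
  exact (cross_mono w).iterate d (subset_sumClosure N)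

/-! ### Deligne-Garside factors and power bounds -/

theorem existsUnique_isDG (hΩ : Ω ≤ twists b) (w : TwistedWeylGroup P Ω) (d : ℕ) :
    ∃! x, IsDG b (braid b w ^ d) x := by
  -- This family is finite and stable under union, so a maximal member is greatest.
  set D : Set (Set ι) := {N | IsCoclosed b N ∧ (cross b w)^[d] N = ∅} with hD
  have hne : D.Nonempty := by
    refine ⟨inversionSet b (1 : TwistedWeylGroup P Ω), isCoclosed_inversionSet 1,
      (isRightFactor_pow_iff hΩ).mp ⟨braid b w ^ d, by rw [braid_one, mul_one]⟩⟩
  obtain ⟨M, hM⟩ := (Set.toFinite D).exists_maximal hne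
  obtain ⟨hMc, hM0⟩ := hM.prop
  have hmax {N : Set ι} (hN : IsCoclosed b N) (h : (cross b w)^[d] N = ∅) : N ⊆ M := by
    have h₁ : N ∪ M ∈ D := ⟨hN.union hMc, by rw [cross_iterate_union, h, hM0, Set.union_empty]⟩
    exact Set.subset_union_left.trans (hM.le_of_ge h₁ Set.subset_union_right)
  obtain ⟨x, hx⟩ := exists_inversionSet_eq_sumClosure Ω hMc
  refine ⟨x, ⟨(isRightFactor_pow_iff hΩ).mpr ?_, fun y hy => ?_⟩, fun y hy => ?_⟩
  · rw [hx]
    exact cross_iterate_sumClosure_eq_empty hMc.1 hM0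
  · rw [weakLE_iff hΩ, hx]
    exact (hmax (isCoclosed_inversionSet y) ((isRightFactor_pow_iff hΩ).mp hy)).trans
      (subset_sumClosure M)
  · refine ofWeyl_inj_of_inversionSet_eq (b := b) (Ω := Ω) (subset_antisymm ?_ ?_)
    · rw [hx]
      exact (hmax (isCoclosed_inversionSet _) ((isRightFactor_pow_iff hΩ).mp hy.1)).trans
        (subset_sumClosure M)
    · refine (weakLE_iff hΩ _ _).mp (hy.2 _ ((isRightFactor_pow_iff hΩ).mpr ?_))
      rw [hx]
      exact cross_iterate_sumClosure_eq_empty hMc.1 hM0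

theorem isDG_DG (hΩ : Ω ≤ twists b) (w : TwistedWeylGroup P Ω) (d : ℕ) :
    IsDG b (braid b w ^ d) (DG b (braid b w ^ d)) :=
  Classical.epsilon_spec (existsUnique_isDG hΩ w d).exists

theorem weakLE_DG_iff (hΩ : Ω ≤ twists b) (w w' : TwistedWeylGroup P Ω) (d : ℕ) :
    WeakLE b w' (ofWeyl (DG b (braid b w ^ d))) ↔ (cross b w)^[d] (inversionSet b w') = ∅ := by
  obtain ⟨h₁, h₂⟩ := isDG_DG hΩ w d
  refine ⟨fun h => ?_, fun h => h₂ _ ((isRightFactor_pow_iff hΩ).mpr h)⟩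
  rw [isRightFactor_pow_iff hΩ] at h₁
  rw [← Set.subset_empty_iff, ← h₁]
  exact (cross_mono w).iterate d ((weakLE_iff hΩ _ _).mp h)

theorem existsUnique_isPowerBound {w : TwistedWeylGroup P Ω}
    (h : IsSumClosed P (posRoots b \ stableRoots b w)) : ∃! x, IsPowerBound b w x := by
  obtain ⟨x, hx⟩ := exists_inversionSet_ofWeyl_eq Ω h (isCoclosed_nonstable w)
  exact ⟨x, hx, fun y hy => ofWeyl_inj_of_inversionSet_eq (hy.trans hx.symm)⟩

theorem isPowerBound_pb {w : TwistedWeylGroup P Ω}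
    (h : IsSumClosed P (posRoots b \ stableRoots b w)) : IsPowerBound b w (pb b w) :=
  Classical.epsilon_spec (existsUnique_isPowerBound h).exists

theorem inversionSet_ofIdx {α : ι} (hα : α ∈ b.support) :
    inversionSet b (ofWeyl (Ω := Ω) (RootPairing.weylGroup.ofIdx P α)) = {α} := by
  rw [inversionSet_ofWeyl]
  ext i
  refine ⟨fun ⟨hi, hn⟩ => ?_, fun h => ?_⟩
  · by_contra hne
    exact hn (isPos_reflection_smul hi hα hne)
  · obtain rfl : i = α := h
    exact ⟨RootPairing.Base.isPos_of_mem_support hα, not_isPos_reflection_smul_self hα⟩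

/-- The set `{α}` is the inversion set of a simple reflection, and its crossing is nonempty because
it contains `w α`. -/
theorem hasSimple_crossRoot (hΩ : Ω ≤ twists b) (w : TwistedWeylGroup P Ω) {α : ι}
    (hα : α ∈ b.support) (h : α ∉ inversionSet b w) : HasSimple b (crossRoot b w α) := by
  have hc := isCoclosed_inversionSet (b := b)
    (ofWeyl (Ω := Ω) (RootPairing.weylGroup.ofIdx P α))
  rw [inversionSet_ofIdx hα] at hc
  have h₁ := cross_iterate_eq_empty_iff hΩ w hc 1
  have e : cross b w {α} = crossRoot b w α := Set.biUnion_singleton _ _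
  rw [Function.iterate_one, e] at h₁
  by_contra hn
  have hp : b.IsPos (toAut w • α) := by
    by_contra hc
    exact h ⟨RootPairing.Base.isPos_of_mem_support hα, hc⟩
  have h₂ := smul_mem_cross w (Set.mem_singleton α) hp
  rw [e, h₁.mpr hn] at h₂
  exact h₂

theorem isConvex_and_DG_eq_pb_iff (hΩ : Ω ≤ twists b) (w : TwistedWeylGroup P Ω) (d : ℕ) :
    (IsConvex b w ∧ DG b (braid b w ^ d) = pb b w) ↔
      (cross b w)^[d] (posRoots b \ stableRoots b w) = ∅ := by
  constructor
  · rintro ⟨hc, e⟩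
    have hpb : inversionSet b (ofWeyl (pb b w)) = _ := isPowerBound_pb hc.isSumClosed
    rw [← hpb, ← weakLE_DG_iff hΩ, e, weakLE_iff hΩ]
  · intro h
    have hs := isSumClosed_nonstable h
    have hpb : inversionSet b (ofWeyl (pb b w)) = _ := isPowerBound_pb hs
    refine ⟨?_, ofWeyl_inj_of_inversionSet_eq (b := b) (Ω := Ω) (subset_antisymm ?_ ?_)⟩
    -- Sum-closedness gives convexity here: a biclosed set is an inversion set, which is cut out by
    -- strict linear inequalities.
    · rw [IsConvex, ← hpb]
      exact isConvexSet_autInversionSet b _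
    · rw [hpb]
      exact subset_nonstable_of_cross_iterate_eq_empty (inversionSet_subset_posRoots _)
        ((isRightFactor_pow_iff hΩ).mp (isDG_DG hΩ w d).1)
    · rw [← weakLE_iff hΩ, weakLE_DG_iff hΩ, hpb]
      exact h

end

end TwistedWeyl

end

theorem mainTheorem2 {ι V V' : Type*} [Finite ι] [AddCommGroup V] [Module ℝ V]
    [AddCommGroup V'] [Module ℝ V'] (P : RootPairing ι ℝ V V')
    [P.IsRootSystem] [P.IsCrystallographic] [P.IsReduced] (b : P.Base)
    (Ω : Subgroup P.Aut) (hΩ : Ω ≤ TwistedWeyl.twists b)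
    (w : TwistedWeyl.TwistedWeylGroup P Ω) :
    -- the Deligne-Garside factors and the braid power bound occurring below are well defined
    ((∀ d : ℕ, ∃! x, TwistedWeyl.IsDG b (TwistedWeyl.braid b w ^ d) x) ∧
      (TwistedWeyl.IsConvex b w → ∃! x, TwistedWeyl.IsPowerBound b w x)) ∧
    -- (i)
    (∀ α ∈ b.support, α ∉ TwistedWeyl.inversionSet b w →
      TwistedWeyl.HasSimple b (TwistedWeyl.crossRoot b w α)) ∧
    -- (ii)
    (∀ (w' : TwistedWeyl.TwistedWeylGroup P Ω) (d : ℕ),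
      (TwistedWeyl.WeakLE b w' (TwistedWeyl.ofWeyl (TwistedWeyl.DG b (TwistedWeyl.braid b w ^ d))) ↔
        (TwistedWeyl.cross b w)^[d] (TwistedWeyl.inversionSet b w') = ∅) ∧
      ((TwistedWeyl.cross b w)^[d] (TwistedWeyl.inversionSet b w') = ∅ ↔
        ¬ TwistedWeyl.HasSimple b
          ((TwistedWeyl.cross b w)^[d] (TwistedWeyl.inversionSet b w')))) ∧
    -- (iii)
    (∀ d : ℕ,
      ((TwistedWeyl.posRoots b \ TwistedWeyl.stableRoots b w).ncard : ℤ) -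
          (TwistedWeyl.length b w : ℤ) < (d : ℤ) →
      ((TwistedWeyl.IsConvex b w ∧
          TwistedWeyl.DG b (TwistedWeyl.braid b w ^ d) = TwistedWeyl.pb b w) ↔
        (TwistedWeyl.cross b w)^[d]
          (TwistedWeyl.posRoots b \ TwistedWeyl.stableRoots b w) = ∅) ∧
      ((TwistedWeyl.cross b w)^[d]
          (TwistedWeyl.posRoots b \ TwistedWeyl.stableRoots b w) = ∅ ↔
        ¬ TwistedWeyl.HasSimple b ((TwistedWeyl.cross b w)^[d]
          (TwistedWeyl.posRoots b \ TwistedWeyl.stableRoots b w)))) := by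
  refine ⟨⟨fun d => TwistedWeyl.existsUnique_isDG hΩ w d,
      fun h => TwistedWeyl.existsUnique_isPowerBound h.isSumClosed⟩,
    fun α hα h => TwistedWeyl.hasSimple_crossRoot hΩ w hα h,
    fun w' d => ⟨TwistedWeyl.weakLE_DG_iff hΩ w w' d,
      TwistedWeyl.cross_iterate_eq_empty_iff hΩ w (TwistedWeyl.isCoclosed_inversionSet w') d⟩,
    fun d _ => ⟨TwistedWeyl.isConvex_and_DG_eq_pb_iff hΩ w d,
      TwistedWeyl.cross_iterate_eq_empty_iff hΩ w (TwistedWeyl.isCoclosed_nonstable w) d⟩⟩
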